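/- Let $X$ be a non-empty compact metric space, $\alpha : X \to X$ a homeomorphism, and $\mathscr{V}$ a complex vector bundle over $X$ (locally trivial, of finite but not necessarily constant rank) with a Hermitian structure. Let $\Gamma(\mathscr{V},\alpha)$ be the $\mathrm{C}^*$-correspondence over $C(X)$ whose right Hilbert $C(X)$-module is the module of continuous sections of $\mathscr{V}$, with the pointwise inner product, and whose left action is $f\xi = \xi\,(f\circ\alpha)$. Let $\mathcal{O} = \mathcal{O}(\Gamma(\mathscr{V},\alpha))$ be its Cuntz--Pimsner algebra, that is, the $\mathrm{C}^*$-algebra generated by the universal covariant representation $(\pi_u,t_u)$ of $\Gamma(\mathscr{V},\alpha)$ (covariant in the sense of Katsura), let $\sigma : \mathbb{T} \to \mathrm{Aut}(\mathcal{O})$ be its gauge action, determined by $\sigma_z(\pi_u(f)) = \pi_u(f)$ and $\sigma_z(t_u(\xi)) = z\,t_u(\xi)$, and let $\Phi(a) = \int_{\mathbb{T}} \sigma_z(a)\,dz$. A line bundle is a vector bundle all of whose fibres have dimension one. 1. If every fibre of $\mathscr{V}$ is non-zero and $\mathscr{V}$ is not a line bundle, then $\mathcal{O}$ has no faithful tracial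 state. 2. If $\mathscr{V}$ is a line bundle, then $\pi_u : C(X) \to \mathcal{O}$ is injective, $\Phi(\mathcal{O}) \subseteq \pi_u(C(X))$, there is an $\alpha$-invariant Borel probability measure on $X$, and for every such measure $\mu$ the map $a \mapsto \int_X \pi_u^{-1}(\Phi(a))\,d\mu$ is a tracial state on $\mathcal{O}$. In particular $\mathcal{O}$ has a tracial state. 3. If $\mathscr{V}$ is a line bundle and $\alpha$ is minimal (the only closed sets $K \subseteq X$ with $\alpha(K) \subseteq K$ are $\emptyset$ and $X$), then $\mathcal{O}$ is stably finite: it is unital and, for every $n$, every isometry in $M_n(\mathcal{O})$ is a unitary. -/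

import Mathlib

open scoped ComplexOrder ENNReal

universe u v w

noncomputable section

/-! ### Correspondences over a commutative C⋆-algebra -/

/-- A C⋆-correspondence over the commutative C⋆-algebra `A`: a (complete) Hilbert `A`-module `E`
with a ⋆-homomorphism `φ` from `A` to the adjointable operators on `E`. As `A` is commutative, the
right action of `A` on `E` is written `a • ξ`. -/
structure CStarCorrespondence (A : Type u) (E : Type v) [CommCStarAlgebra A] [PartialOrder A]
    [StarOrderedRing A] [NormedAddCommGroup E] [NormedSpace ℂ E] [CompleteSpace E] [SMul A E]
    [CStarModule A E] where
  /-- The structure map. -/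
  φ : A →ₙₐ[ℂ] (E →L[ℂ] E)
  /-- `φ a` is adjointable with adjoint `φ (star a)`. -/
  inner_φ_left : ∀ (a : A) (ξ η : E), inner A (φ a ξ) η = inner A ξ (φ (star a) η)

section HilbertModule

variable (A : Type u) {E : Type v} [CommCStarAlgebra A] [PartialOrder A]
  [NormedAddCommGroup E] [NormedSpace ℂ E] [SMul A E] [CStarModule A E]

theorem CStarModule.smul_ext_inner {x y : E} (h : ∀ z : E, inner A z x = inner A z y) :
    x = y := by
  rw [← sub_eq_zero, ← CStarModule.inner_self (A := A)]
  rw [CStarModule.inner_sub_right, h, sub_self]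

theorem CStarModule.norm_smul_le' (a : A) (x : E) : ‖a • x‖ ≤ ‖a‖ * ‖x‖ := by
  have h : ‖a • x‖ ^ 2 ≤ (‖a‖ * ‖x‖) ^ 2 := by
    rw [CStarModule.norm_sq_eq A, CStarModule.inner_op_smul_right, CStarModule.inner_op_smul_left,
      mul_pow, CStarModule.norm_sq_eq A (x := x)]
    calc _ ≤ ‖a‖ * (‖inner A x x‖ * ‖star a‖) :=
          (norm_mul_le _ _).trans (by gcongr; exact norm_mul_le _ _)
      _ = _ := by rw [norm_star]; ring
  exact le_of_sq_le_sq h (by positivity)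

variable [StarOrderedRing A]

/-- The rank one operator `θ_{ξ,η} ζ = ξ ⟨η, ζ⟩`. -/
def rankOneOp (ξ η : E) : E →L[ℂ] E :=
  LinearMap.mkContinuous
    { toFun := fun ζ => inner A η ζ • ξ
      map_add' := fun x y => CStarModule.smul_ext_inner A fun z => by
        simp [add_mul]
      map_smul' := fun c x => CStarModule.smul_ext_inner A fun z => by
        simp }
    (‖η‖ * ‖ξ‖) fun ζ => by
      have h1 := CStarModule.norm_smul_le' A (inner A η ζ) ξ
      have h2 : ‖inner A η ζ‖ ≤ ‖η‖ * ‖ζ‖ := CStarModule.norm_inner_le E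
      calc _ ≤ ‖inner A η ζ‖ * ‖ξ‖ := h1
        _ ≤ (‖η‖ * ‖ζ‖) * ‖ξ‖ := by gcongr
        _ = _ := by ring

/-- The compact operators `K(E)`: the closed linear span of the rank one operators. -/
def compactOps (E : Type v) [NormedAddCommGroup E] [NormedSpace ℂ E] [SMul A E] [CStarModule A E] :
    Submodule ℂ (E →L[ℂ] E) :=
  (Submodule.span ℂ {T | ∃ ξ η : E, T = rankOneOp A ξ η}).topologicalClosure

theorem rankOneOp_mem (ξ η : E) : rankOneOp A ξ η ∈ compactOps A E :=
  Submodule.le_topologicalClosure _ (Submodule.subset_span ⟨ξ, η, rfl⟩)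

end HilbertModule

namespace CStarCorrespondence

variable {A : Type u} {E : Type v} [CommCStarAlgebra A] [PartialOrder A] [StarOrderedRing A]
  [NormedAddCommGroup E] [NormedSpace ℂ E] [CompleteSpace E] [SMul A E] [CStarModule A E]
  (C : CStarCorrespondence A E)

/-- Katsura's ideal `J_E = φ⁻¹(K(E)) ∩ (ker φ)^⊥`. -/
def katsuraIdeal : Set A :=
  {a | C.φ a ∈ compactOps A E ∧ ∀ b, C.φ b = 0 → a * b = 0}

/-- A representation `(π, t)` of the correspondence on a C⋆-algebra `B`. -/
structure Representation (B : Type w) [NonUnitalCStarAlgebra B] where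
  π : A →⋆ₙₐ[ℂ] B
  t : E →ₗ[ℂ] B
  inner_eq : ∀ ξ η : E, π (inner A ξ η) = star (t ξ) * t η
  left_mul : ∀ (a : A) (ξ : E), π a * t ξ = t (C.φ a ξ)

/-- `(π, t)` is covariant if `π a = ψ (φ a)` on Katsura's ideal, where `ψ : K(E) → B` is the map
with `ψ θ_{ξ,η} = t ξ (t η)⋆`. A continuous linear `ψ` with this property is unique. -/
def Representation.IsCovariant {C : CStarCorrespondence A E} {B : Type w}
    [NonUnitalCStarAlgebra B] (ρ : C.Representation B) : Prop :=
  ∃ ψ : compactOps A E →L[ℂ] B,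
    (∀ ξ η : E, ψ ⟨rankOneOp A ξ η, rankOneOp_mem A ξ η⟩ = ρ.t ξ * star (ρ.t η)) ∧
    ∀ (a : A) (ha : a ∈ C.katsuraIdeal), ρ.π a = ψ ⟨C.φ a, ha.1⟩

/-- The covariant representations of the correspondence on C⋆-algebras in `Type (max u v)`. -/
structure CovariantRep where
  B : Type (max u v)
  [cstar : NonUnitalCStarAlgebra B]
  ρ : C.Representation B
  covariant : ρ.IsCovariant

attribute [instance] CovariantRep.cstar

/-- The C⋆-algebra of bounded families indexed by all covariant representations. -/
abbrev RepProduct : Type (max (u + 1) (v + 1)) := lp (fun i : C.CovariantRep => i.B) ∞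

variable {C} in
theorem Representation.norm_t_le {B : Type w} [NonUnitalCStarAlgebra B]
    (ρ : C.Representation B) (ξ : E) : ‖ρ.t ξ‖ ≤ ‖ξ‖ := by
  have h : ‖ρ.t ξ‖ ^ 2 ≤ ‖ξ‖ ^ 2 := by
    rw [CStarModule.norm_sq_eq A (x := ξ), pow_two, ← CStarRing.norm_star_mul_self, ← ρ.inner_eq]
    exact NonUnitalStarAlgHom.norm_apply_le ρ.π _
  exact le_of_sq_le_sq h (norm_nonneg _)

/-- The direct product of all the `π`'s. -/
def prodπ : A →⋆ₙₐ[ℂ] C.RepProduct where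
  toFun a := ⟨fun i => i.ρ.π a, memℓp_infty ⟨‖a‖, by
    rintro _ ⟨i, rfl⟩; exact NonUnitalStarAlgHom.norm_apply_le i.ρ.π a⟩⟩
  map_smul' c a := by ext i; exact map_smul i.ρ.π c a
  map_zero' := by ext i; exact map_zero i.ρ.π
  map_add' a b := by ext i; exact map_add i.ρ.π a b
  map_mul' a b := by ext i; exact map_mul i.ρ.π a b
  map_star' a := by ext i; exact map_star i.ρ.π a

/-- The direct product of all the `t`'s. -/
def prodT : E →ₗ[ℂ] C.RepProduct where
  toFun ξ := ⟨fun i => i.ρ.t ξ, memℓp_infty ⟨‖ξ‖, by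
    rintro _ ⟨i, rfl⟩; exact i.ρ.norm_t_le ξ⟩⟩
  map_smul' c a := by ext i; exact map_smul i.ρ.t c a
  map_add' a b := by ext i; exact map_add i.ρ.t a b

/-- The C⋆-subalgebra generated by the direct product of all covariant representations. -/
def cuntzPimsnerSubalgebra : NonUnitalStarSubalgebra ℂ C.RepProduct :=
  (NonUnitalStarAlgebra.adjoin ℂ (Set.range C.prodπ ∪ Set.range C.prodT)).topologicalClosure

/-- The Cuntz–Pimsner algebra `O(E)`: the C⋆-algebra generated by the universal covariant
representation, realised as the direct product of all covariant representations. Any C⋆-algebra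
generated by a covariant representation is isomorphic to one in `Type (max u v)`, so every covariant
representation factors through this one. -/
def CuntzPimsner : Type (max (u + 1) (v + 1)) := C.cuntzPimsnerSubalgebra

instance : NonUnitalCStarAlgebra C.CuntzPimsner :=
  NonUnitalStarSubalgebra.nonUnitalCStarAlgebra C.cuntzPimsnerSubalgebra
    (h_closed := NonUnitalStarSubalgebra.isClosed_topologicalClosure _)

theorem prodπ_mem (a : A) : C.prodπ a ∈ C.cuntzPimsnerSubalgebra :=
  NonUnitalStarSubalgebra.le_topologicalClosure _
    (NonUnitalStarAlgebra.subset_adjoin ℂ _ (Or.inl ⟨a, rfl⟩))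

theorem prodT_mem (ξ : E) : C.prodT ξ ∈ C.cuntzPimsnerSubalgebra :=
  NonUnitalStarSubalgebra.le_topologicalClosure _
    (NonUnitalStarAlgebra.subset_adjoin ℂ _ (Or.inr ⟨ξ, rfl⟩))

/-- The coefficient map `π_u : A → O(E)` of the universal covariant representation. -/
def coeff : A →⋆ₙₐ[ℂ] C.CuntzPimsner where
  toFun a := ⟨C.prodπ a, C.prodπ_mem a⟩
  map_smul' c a := Subtype.ext (map_smul C.prodπ c a)
  map_zero' := Subtype.ext (map_zero C.prodπ)
  map_add' a b := Subtype.ext (map_add C.prodπ a b)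
  map_mul' a b := Subtype.ext (map_mul C.prodπ a b)
  map_star' a := Subtype.ext (map_star C.prodπ a)

/-- The module map `t_u : E → O(E)` of the universal covariant representation. -/
def creation : E →ₗ[ℂ] C.CuntzPimsner where
  toFun ξ := ⟨C.prodT ξ, C.prodT_mem ξ⟩
  map_smul' c a := Subtype.ext (map_smul C.prodT c a)
  map_add' a b := Subtype.ext (map_add C.prodT a b)

/-! ### The gauge action -/

variable {C} in
/-- The covariant representation `(π, z t)`. -/
abbrev CovariantRep.twist (z : Circle) (i : C.CovariantRep) : C.CovariantRep where
  B := i.B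
  ρ :=
    { π := i.ρ.π
      t := (z : ℂ) • i.ρ.t
      inner_eq := fun ξ η => by
        have hz : star (z : ℂ) * (z : ℂ) = 1 := by
          simp [← Complex.normSq_eq_conj_mul_self]
        rw [i.ρ.inner_eq, LinearMap.smul_apply, LinearMap.smul_apply, star_smul, smul_mul_smul_comm,
          hz, one_smul]
      left_mul := fun a ξ => by
        rw [LinearMap.smul_apply, LinearMap.smul_apply, mul_smul_comm, i.ρ.left_mul] }
  covariant := by
    obtain ⟨ψ, h1, h2⟩ := i.covariant
    refine ⟨ψ, fun ξ η => ?_, h2⟩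
    have hz : (z : ℂ) * star (z : ℂ) = 1 := by
      simp [Complex.mul_conj]
    rw [h1, LinearMap.smul_apply, LinearMap.smul_apply, star_smul, smul_mul_smul_comm, hz, one_smul]

/-- Reindexing of bounded families along `(π, t) ↦ (π, z t)`. -/
def prodGauge (z : Circle) : C.RepProduct →⋆ₙₐ[ℂ] C.RepProduct where
  toFun x := ⟨fun i => x (i.twist z), memℓp_infty ⟨‖x‖, by
    rintro _ ⟨i, rfl⟩; exact lp.norm_apply_le_norm ENNReal.top_ne_zero x (i.twist z)⟩⟩
  map_smul' _ _ := rfl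
  map_zero' := rfl
  map_add' _ _ := rfl
  map_mul' _ _ := rfl
  map_star' _ := rfl

theorem prodGauge_prodπ (z : Circle) (a : A) : C.prodGauge z (C.prodπ a) = C.prodπ a := rfl

theorem prodGauge_prodT (z : Circle) (ξ : E) :
    C.prodGauge z (C.prodT ξ) = C.prodT ((z : ℂ) • ξ) := by
  ext i
  exact (map_smul i.ρ.t (z : ℂ) ξ).symm

theorem prodGauge_mem (z : Circle) {x : C.RepProduct} (hx : x ∈ C.cuntzPimsnerSubalgebra) :
    C.prodGauge z x ∈ C.cuntzPimsnerSubalgebra := by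
  have hc : Continuous (C.prodGauge z) :=
    AddMonoidHomClass.continuous_of_bound (C.prodGauge z) 1 fun x => by
      rw [one_mul]; exact NonUnitalStarAlgHom.norm_apply_le (C.prodGauge z) x
  have hcl : IsClosed (C.cuntzPimsnerSubalgebra : Set C.RepProduct) :=
    NonUnitalStarSubalgebra.isClosed_topologicalClosure _
  have h : C.cuntzPimsnerSubalgebra ≤ C.cuntzPimsnerSubalgebra.comap (C.prodGauge z) := by
    refine NonUnitalStarSubalgebra.topologicalClosure_minimal _ ?_ (hcl.preimage hc)
    rw [NonUnitalStarAlgebra.adjoin_le_iff]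
    rintro _ (⟨a, rfl⟩ | ⟨ξ, rfl⟩)
    · exact C.prodπ_mem a
    · change C.prodGauge z (C.prodT ξ) ∈ C.cuntzPimsnerSubalgebra
      rw [prodGauge_prodT]
      exact C.prodT_mem _
  exact h hx

/-- The gauge action of the circle on `O(E)`: `σ_z (π_u a) = π_u a` and `σ_z (t_u ξ) = z t_u ξ`. -/
def gauge (z : Circle) : C.CuntzPimsner →⋆ₙₐ[ℂ] C.CuntzPimsner where
  toFun x := ⟨C.prodGauge z x.1, C.prodGauge_mem z x.2⟩
  map_smul' _ _ := rfl
  map_zero' := rfl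
  map_add' _ _ := rfl
  map_mul' _ _ := rfl
  map_star' _ := rfl

theorem gauge_coeff (z : Circle) (a : A) : C.gauge z (C.coeff a) = C.coeff a := rfl

theorem gauge_creation (z : Circle) (ξ : E) :
    C.gauge z (C.creation ξ) = (z : ℂ) • C.creation ξ := by
  rw [← map_smul]
  exact Subtype.ext (C.prodGauge_prodT z ξ)

/-- The gauge expectation `Φ a = ∫_𝕋 σ_z(a) dz` (normalised Haar measure, `z = exp (2π i s)`). -/
def gaugeExpectation (a : C.CuntzPimsner) : C.CuntzPimsner :=
  ∫ s in (0 : ℝ)..1, C.gauge (Circle.exp (2 * Real.pi * s)) a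

end CStarCorrespondence

/-! ### Traces and stable finiteness -/

section Traces

variable {B : Type w} [NonUnitalCStarAlgebra B]

/-- A tracial state: a positive linear functional of norm one with `τ (a b) = τ (b a)`. -/
structure IsTracialState (τ : B →L[ℂ] ℂ) : Prop where
  nonneg : ∀ a, 0 ≤ τ (star a * a)
  norm_eq_one : ‖τ‖ = 1
  tracial : ∀ a b, τ (a * b) = τ (b * a)

/-- A functional is faithful if it vanishes on `a⋆ a` only for `a = 0`. -/
def IsFaithfulFunctional (τ : B →L[ℂ] ℂ) : Prop :=
  ∀ a, τ (star a * a) = 0 → a = 0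

/-- `B` is a unital C⋆-algebra (with unit `e`) and every isometry in every matrix algebra over `B`
is a unitary. -/
def IsStablyFiniteCStar (B : Type w) [NonUnitalCStarAlgebra B] : Prop :=
  ∃ e : B, (∀ b, e * b = b ∧ b * e = b) ∧
    ∀ (n : ℕ) (s : Matrix (Fin n) (Fin n) B),
      s.conjTranspose * s = Matrix.diagonal (fun _ => e) →
        s * s.conjTranspose = Matrix.diagonal (fun _ => e)

end Traces

/-! ### Hermitian vector bundles and their sections -/

open Bundle in
/-- A complex vector bundle over `X`, of finite but not necessarily constant rank, with a Hermitian
structure. The total space is the disjoint union of the fibres (the first argument of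
`TotalSpace` is only a label); near every point there is a chart that is a fibrewise linear isometry
onto some `ℂⁿ`. -/
structure HermitianVectorBundle (X : Type u) [TopologicalSpace X] where
  Fiber : X → Type v
  [normedAddCommGroup : ∀ x, NormedAddCommGroup (Fiber x)]
  [innerProductSpace : ∀ x, InnerProductSpace ℂ (Fiber x)]
  [topology : TopologicalSpace (TotalSpace Unit Fiber)]
  exists_chart : ∀ x, ∃ (n : ℕ) (e : Trivialization (EuclideanSpace ℂ (Fin n))
    (TotalSpace.proj : TotalSpace Unit Fiber → X)), x ∈ e.baseSet ∧
      ∀ y ∈ e.baseSet, ∃ L : Fiber y ≃ₗᵢ[ℂ] EuclideanSpace ℂ (Fin n), ∀ v, (e ⟨y, v⟩).2 = L v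

attribute [instance] HermitianVectorBundle.normedAddCommGroup
  HermitianVectorBundle.innerProductSpace HermitianVectorBundle.topology

namespace HermitianVectorBundle

open Bundle Filter Topology

section Basic

variable {X : Type u} [TopologicalSpace X] (V : HermitianVectorBundle.{u, v} X)

/-- A line bundle: all fibres have dimension one. -/
def IsLineBundle : Prop := ∀ x, Module.finrank ℂ (V.Fiber x) = 1

/-- Continuity of a section of the bundle. -/
def IsContinuousSection (s : ∀ x, V.Fiber x) : Prop :=
  Continuous fun x => (⟨x, s x⟩ : TotalSpace Unit V.Fiber)

theorem continuousAt_section_iff {s : ∀ x, V.Fiber x} {x : X} {n : ℕ}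
    (e : Trivialization (EuclideanSpace ℂ (Fin n))
      (TotalSpace.proj : TotalSpace Unit V.Fiber → X)) (hx : x ∈ e.baseSet) :
    ContinuousAt (fun x => (⟨x, s x⟩ : TotalSpace Unit V.Fiber)) x ↔
      ContinuousAt (fun y => (e ⟨y, s y⟩).2) x := by
  constructor
  · intro h
    have he : ContinuousAt e (⟨x, s x⟩ : TotalSpace Unit V.Fiber) :=
      e.continuousAt (e.mem_source.2 hx)
    exact (he.comp (f := fun x => (⟨x, s x⟩ : TotalSpace Unit V.Fiber)) h).snd
  · intro h
    refine e.continuousAt_of_comp_left (f := fun x => (⟨x, s x⟩ : TotalSpace Unit V.Fiber))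
      continuousAt_id hx ?_
    have h2 : ContinuousAt (fun y => ((y, (e ⟨y, s y⟩).2) : X × EuclideanSpace ℂ (Fin n))) x :=
      continuousAt_id.prodMk h
    refine h2.congr ?_
    filter_upwards [e.open_baseSet.mem_nhds hx] with y hy
    exact Prod.ext (e.proj_toFun ⟨y, s y⟩ (e.mem_source.2 hy)).symm rfl

/-- The complex vector space of continuous sections. -/
def sectionSubmodule : Submodule ℂ (∀ x, V.Fiber x) where
  carrier := {s | V.IsContinuousSection s}
  zero_mem' := by
    refine continuous_iff_continuousAt.2 fun x => ?_
    obtain ⟨n, e, hx, hL⟩ := V.exists_chart x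
    refine (V.continuousAt_section_iff e hx).2 ?_
    refine (continuousAt_const (y := 0)).congr ?_
    filter_upwards [e.open_baseSet.mem_nhds hx] with y hy
    obtain ⟨L, hL⟩ := hL y hy
    simp [hL]
  add_mem' := by
    intro s t hs ht
    refine continuous_iff_continuousAt.2 fun x => ?_
    obtain ⟨n, e, hx, hL⟩ := V.exists_chart x
    refine (V.continuousAt_section_iff e hx).2 ?_
    refine (((V.continuousAt_section_iff e hx).1 (continuous_iff_continuousAt.1 hs x)).add
      ((V.continuousAt_section_iff e hx).1 (continuous_iff_continuousAt.1 ht x))).congr ?_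
    filter_upwards [e.open_baseSet.mem_nhds hx] with y hy
    obtain ⟨L, hL⟩ := hL y hy
    simp [hL]
  smul_mem' := by
    intro c s hs
    refine continuous_iff_continuousAt.2 fun x => ?_
    obtain ⟨n, e, hx, hL⟩ := V.exists_chart x
    refine (V.continuousAt_section_iff e hx).2 ?_
    refine (((V.continuousAt_section_iff e hx).1 (continuous_iff_continuousAt.1 hs x)).const_smul
      c).congr ?_
    filter_upwards [e.open_baseSet.mem_nhds hx] with y hy
    obtain ⟨L, hL⟩ := hL y hy
    simp [hL]

/-- The space `Γ(V)` of continuous sections. -/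
structure Sections : Type (max u v) where
  toFun : ∀ x, V.Fiber x
  continuous_toFun : V.IsContinuousSection toFun

/-- Bundled sections form a copy of the vector space of continuous sections. -/
def sectionsEquiv : V.Sections ≃ V.sectionSubmodule where
  toFun s := ⟨s.toFun, s.continuous_toFun⟩
  invFun s := ⟨s.1, s.2⟩

instance : AddCommGroup V.Sections := V.sectionsEquiv.addCommGroup

instance : Module ℂ V.Sections := V.sectionsEquiv.module ℂ

instance : CoeFun V.Sections fun _ => ∀ x, V.Fiber x := ⟨fun s => s.toFun⟩

variable {V}

@[ext] theorem Sections.ext {s t : V.Sections} (h : ∀ x, s x = t x) : s = t := by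
  cases s; cases t; congr; exact funext h

@[simp] theorem Sections.add_apply (s t : V.Sections) (x : X) : (s + t) x = s x + t x := rfl

@[simp] theorem Sections.sub_apply (s t : V.Sections) (x : X) : (s - t) x = s x - t x := rfl

@[simp] theorem Sections.zero_apply (x : X) : (0 : V.Sections) x = 0 := rfl

@[simp] theorem Sections.smul_apply (c : ℂ) (s : V.Sections) (x : X) : (c • s) x = c • s x := rfl

/-- Pointwise multiplication of a section by a continuous function. -/
instance : SMul C(X, ℂ) V.Sections where
  smul f s := ⟨fun x => f x • s x, by
    refine continuous_iff_continuousAt.2 fun x => ?_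
    obtain ⟨n, e, hx, hL⟩ := V.exists_chart x
    refine (V.continuousAt_section_iff e hx).2 ?_
    refine (f.continuous.continuousAt.smul
      ((V.continuousAt_section_iff e hx).1 (continuous_iff_continuousAt.1 s.continuous_toFun x))).congr ?_
    filter_upwards [e.open_baseSet.mem_nhds hx] with y hy
    obtain ⟨L, hL⟩ := hL y hy
    simp [hL]⟩

@[simp] theorem Sections.fun_smul_apply (f : C(X, ℂ)) (s : V.Sections) (x : X) :
    (f • s) x = f x • s x := rfl

/-- The pointwise `C(X)`-valued inner product of sections (linear in the second variable). -/
instance : Inner C(X, ℂ) V.Sections where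
  inner s t :=
    { toFun := fun x => inner ℂ (s x) (t x)
      continuous_toFun := by
        refine continuous_iff_continuousAt.2 fun x => ?_
        obtain ⟨n, e, hx, hL⟩ := V.exists_chart x
        have hs := (V.continuousAt_section_iff e hx).1 (continuous_iff_continuousAt.1 s.continuous_toFun x)
        have ht := (V.continuousAt_section_iff e hx).1 (continuous_iff_continuousAt.1 t.continuous_toFun x)
        refine (ContinuousAt.inner (𝕜 := ℂ) hs ht).congr ?_
        filter_upwards [e.open_baseSet.mem_nhds hx] with y hy
        obtain ⟨L, hL⟩ := hL y hy
        simp [hL] }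

@[simp] theorem Sections.inner_apply (s t : V.Sections) (x : X) :
    inner C(X, ℂ) s t x = inner ℂ (s x) (t x) := rfl

theorem completeSpace_fiber (V : HermitianVectorBundle.{u, v} X) (x : X) :
    CompleteSpace (V.Fiber x) := by
  obtain ⟨n, e, hx, hL⟩ := V.exists_chart x
  obtain ⟨L, -⟩ := hL x hx
  exact (completeSpace_congr (e := L.toEquiv) L.isometry.isUniformEmbedding).2 inferInstance

end Basic

section Compact

variable {X : Type u} [TopologicalSpace X] [CompactSpace X] {V : HermitianVectorBundle.{u, v} X}

instance : Norm V.Sections := CStarModule.norm C(X, ℂ)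

instance : CStarModule C(X, ℂ) V.Sections where
  inner_add_right {x y z} := by ext p; exact _root_.inner_add_right _ _ _
  inner_self_nonneg {x} := by
    intro p
    change (0 : ℂ) ≤ inner ℂ (x p) (x p)
    rw [inner_self_eq_norm_sq_to_K]
    norm_cast
    exact Complex.zero_le_real.2 (sq_nonneg ‖x p‖)
  inner_self {x} := by
    constructor
    · intro h
      ext p
      have := DFunLike.congr_fun h p
      simpa using this
    · rintro rfl
      ext p
      simp
  inner_op_smul_right {a x y} := by ext p; exact _root_.inner_smul_right _ _ _
  inner_smul_right_complex {z x y} := by ext p; exact _root_.inner_smul_right _ _ _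
  star_inner x y := by ext p; simp
  norm_eq_sqrt_norm_inner_self x := rfl

instance : NormedAddCommGroup V.Sections :=
  NormedAddCommGroup.ofCore (CStarModule.normedSpaceCore C(X, ℂ))

instance : NormedSpace ℂ V.Sections :=
  NormedSpace.ofCore (CStarModule.normedSpaceCore C(X, ℂ))

theorem Sections.norm_apply_le (s : V.Sections) (x : X) : ‖s x‖ ≤ ‖s‖ := by
  have h : ‖s x‖ ^ 2 ≤ ‖s‖ ^ 2 := by
    rw [CStarModule.norm_sq_eq C(X, ℂ) (x := s)]
    refine le_trans (le_of_eq ?_) (ContinuousMap.norm_coe_le_norm (inner C(X, ℂ) s s) x)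
    rw [Sections.inner_apply, inner_self_eq_norm_sq_to_K]
    simp
  exact le_of_sq_le_sq h (norm_nonneg _)

theorem Sections.norm_le_of_forall {s : V.Sections} {c : ℝ} (hc : 0 ≤ c)
    (h : ∀ x, ‖s x‖ ≤ c) : ‖s‖ ≤ c := by
  refine le_of_sq_le_sq ?_ hc
  rw [CStarModule.norm_sq_eq C(X, ℂ), ContinuousMap.norm_le _ (by positivity)]
  intro x
  rw [Sections.inner_apply, inner_self_eq_norm_sq_to_K]
  simpa using pow_le_pow_left₀ (norm_nonneg _) (h x) 2

instance : CompleteSpace V.Sections := by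
  refine Metric.complete_of_cauchySeq_tendsto fun u hu => ?_
  have hcs := fun x => completeSpace_fiber V x
  have hpt : ∀ x, CauchySeq fun k => u k x := by
    intro x
    rw [Metric.cauchySeq_iff] at hu ⊢
    intro ε hε
    obtain ⟨N, hN⟩ := hu ε hε
    refine ⟨N, fun m hm k hk => lt_of_le_of_lt ?_ (hN m hm k hk)⟩
    rw [dist_eq_norm, dist_eq_norm]
    exact Sections.norm_apply_le (u m - u k) x
  choose l hl using fun x => cauchySeq_tendsto_of_complete (hpt x)
  have hunif : ∀ ε > 0, ∃ N, ∀ m ≥ N, ∀ x, ‖u m x - l x‖ ≤ ε := by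
    intro ε hε
    obtain ⟨N, hN⟩ := Metric.cauchySeq_iff.1 hu ε hε
    refine ⟨N, fun m hm x => ?_⟩
    have ht : Tendsto (fun k => ‖u m x - u k x‖) atTop (𝓝 ‖u m x - l x‖) :=
      (tendsto_const_nhds.sub (hl x)).norm
    refine le_of_tendsto ht ?_
    filter_upwards [eventually_ge_atTop N] with k hk
    have := (hN m hm k hk).le
    rw [dist_eq_norm] at this
    exact (Sections.norm_apply_le (u m - u k) x).trans this
  have hcont : V.IsContinuousSection l := by
    refine continuous_iff_continuousAt.2 fun x => ?_
    obtain ⟨n, e, hx, hL⟩ := V.exists_chart x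
    refine (V.continuousAt_section_iff e hx).2 ?_
    refine continuousAt_of_locally_uniform_approx_of_continuousAt fun U hU => ?_
    obtain ⟨ε, hε, hεU⟩ := Metric.mem_uniformity_dist.1 hU
    obtain ⟨N, hN⟩ := hunif (ε / 2) (by positivity)
    refine ⟨e.baseSet, e.open_baseSet.mem_nhds hx, fun y => (e ⟨y, u N y⟩).2,
      (V.continuousAt_section_iff e hx).1 (continuous_iff_continuousAt.1 (u N).continuous_toFun x), ?_⟩
    intro y hy
    apply hεU
    obtain ⟨L, hL⟩ := hL y hy
    change dist (e ⟨y, l y⟩).2 (e ⟨y, u N y⟩).2 < ε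
    rw [hL, hL, L.dist_map, dist_eq_norm, norm_sub_rev]
    exact (hN N le_rfl y).trans_lt (by linarith)
  refine ⟨⟨l, hcont⟩, Metric.tendsto_atTop.2 fun ε hε => ?_⟩
  obtain ⟨N, hN⟩ := hunif (ε / 2) (by positivity)
  refine ⟨N, fun m hm => ?_⟩
  rw [dist_eq_norm]
  refine lt_of_le_of_lt (Sections.norm_le_of_forall (by positivity) fun x => ?_) (half_lt_self hε)
  exact hN m hm x

/-- The correspondence `Γ(V, α)`: the Hilbert `C(X)`-module of continuous sections, with left action
`φ f ξ = ξ (f ∘ α)`. -/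
def correspondence (V : HermitianVectorBundle.{u, v} X) (α : X ≃ₜ X) :
    CStarCorrespondence C(X, ℂ) V.Sections where
  φ :=
    { toFun := fun f => LinearMap.mkContinuous
        { toFun := fun ξ => f.comp (α : C(X, X)) • ξ
          map_add' := fun ξ η => by ext x; simp
          map_smul' := fun c ξ => by ext x; simp [smul_comm c] }
        ‖f‖ fun ξ => Sections.norm_le_of_forall (by positivity) fun x => by
          change ‖f (α x) • ξ x‖ ≤ _
          rw [norm_smul]
          gcongr
          · exact f.norm_coe_le_norm _
          · exact ξ.norm_apply_le x
      map_smul' := fun c f => by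
        ext ξ x; exact smul_assoc c (f (α x)) (ξ x)
      map_zero' := by ext ξ x; exact zero_smul ℂ (ξ x)
      map_add' := fun f g => by ext ξ x; exact add_smul (f (α x)) (g (α x)) (ξ x)
      map_mul' := fun f g => by ext ξ x; exact mul_smul (f (α x)) (g (α x)) (ξ x) }
  inner_φ_left f ξ η := by
    ext x
    change inner ℂ (f (α x) • ξ x) (η x) = inner ℂ (ξ x) (star (f (α x)) • η x)
    rw [_root_.inner_smul_left, _root_.inner_smul_right]
    rfl

end Compact

end HermitianVectorBundle

/-- A homeomorphism is minimal if the only closed sets `K` with `α(K) ⊆ K` are `∅` and `X`. -/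
def IsMinimalHomeo {X : Type u} [TopologicalSpace X] (α : X ≃ₜ X) : Prop :=
  ∀ K : Set X, IsClosed K → α '' K ⊆ K → K = ∅ ∨ K = Set.univ

end

/-!
Everything rests on two constructions.

*Frames.* A partition of unity glues local orthonormal frames to sections `ξᵢ` with
`∑ ξᵢ ⟨ξᵢ, η⟩ = η` for every section `η` (`HermitianVectorBundle.exists_pointwise_frame`). So the
identity of `Γ(V)` is a compact operator, Katsura's ideal is all of `C(X)` when no fibre vanishes,
and covariance amounts to `∑ t(ξᵢ) t(ξᵢ)⋆ = π(1)`. If `τ` is a trace, then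
`τ(π(1)) = ∑ τ(t(ξᵢ) t(ξᵢ)⋆) = ∑ τ(t(ξᵢ)⋆ t(ξᵢ)) = τ(π(dim V))`. When `τ` is faithful, the
non-negative function `dim V - 1` is killed by `π`, and it vanishes as soon as `π` is injective
(`HermitianVectorBundle.isLineBundle_of_faithful_trace`).

*A faithful covariant representation.* On `ℓ²(X × ℕ)` let `π(f)` be multiplication by `f` and, with
`n = dim V_x` and an orthonormal basis of `V_x`, let `t(ξ)` map `δ_{x,k}` to
`∑_{i < n} ξ(x)ᵢ δ_{α x, k n + i}`: the basis of `V_x` acts by `n` isometries with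
orthogonal ranges spanning the space over `α x` (`HermitianVectorBundle.orbitRep`). Its vector
states at the `δ_{x,0}` show that `π_u` is injective and reflects positivity.

For a line bundle `t(ξ) t(η)⋆ = π(⟨η, ξ⟩ ∘ α⁻¹)`. Hence the words `t(ξ₁) ⋯ t(ξₙ) π(f)` and
`t(ξ₁)⋆ ⋯ t(ξₙ)⋆ π(f)` are mapped to words by left multiplication with generators and span a
dense subspace (`CStarCorrespondence.IsRankOne.closure_span_isWord`). The gauge expectation
annihilates the words of non-zero degree, so it takes values in `π(C(X))`. Composing it with an invariant
measure gives a trace: on words of opposite degrees the trace property reduces to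
`∫ ⟨η, ξ⟩ ∘ α⁻¹ dμ = ∫ ⟨η, ξ⟩ dμ`
(`CStarCorrespondence.IsRankOne.isTracialState_comp_expectation`). If `α` is minimal, the measure
has full support, and the trace is faithful because the gauge expectation is
(`CStarCorrespondence.eq_zero_of_gaugeExpectation_eq_zero`). A unital C⋆-algebra with a faithful
trace is stably finite.
-/

noncomputable section

/-! ### Representations of correspondences with a finite frame -/

namespace CStarCorrespondence

variable {A : Type u} {E : Type v} [CommCStarAlgebra A] [PartialOrder A] [StarOrderedRing A]
  [NormedAddCommGroup E] [NormedSpace ℂ E] [CompleteSpace E] [SMul A E] [CStarModule A E]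
  (C : CStarCorrespondence A E)

theorem φ_smul (a b : A) (ξ : E) : C.φ a (b • ξ) = b • C.φ a ξ := by
  refine CStarModule.smul_ext_inner A fun z => ?_
  have h : ∀ η : E, inner A z (C.φ a η) = inner A (C.φ (star a) z) η := fun η => by
    rw [C.inner_φ_left, star_star]
  rw [CStarModule.inner_op_smul_right, h, h, CStarModule.inner_op_smul_right]

namespace Representation

variable {C} {B : Type w} [NonUnitalCStarAlgebra B] (ρ : C.Representation B)

/-- The square of the norm of `t(ξ a) - t(ξ) π(a)` is the image under `π` of an expression in
`⟨ξ, ξ⟩` and `a` that vanishes. -/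
theorem t_smul (a : A) (ξ : E) : ρ.t (a • ξ) = ρ.t ξ * ρ.π a := by
  rw [← sub_eq_zero, ← CStarRing.star_mul_self_eq_zero_iff]
  simp only [star_sub, sub_mul, mul_sub, star_mul, ← map_star ρ.π, mul_assoc]
  simp only [← mul_assoc (star (ρ.t _)) (ρ.t _), ← ρ.inner_eq, ← map_mul,
    CStarModule.inner_op_smul_right, CStarModule.inner_op_smul_left]
  rw [← map_sub, ← map_sub, ← map_sub]
  convert map_zero ρ.π using 2
  ring

end Representation

/-- A finite frame of a Hilbert module: a finite family `ξ` with `∑ᵢ ξᵢ ⟨ξᵢ, η⟩ = η` for all `η`.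
Equivalently, the identity is the compact operator `∑ᵢ θ_{ξᵢ,ξᵢ}`. -/
def IsFrame (A : Type u) {E : Type v} [CommCStarAlgebra A] [PartialOrder A]
    [NormedAddCommGroup E] [NormedSpace ℂ E] [SMul A E] [CStarModule A E]
    {ι : Type*} [Fintype ι] (ξ : ι → E) : Prop :=
  ∀ η : E, ∑ i, (inner A (ξ i) η : A) • ξ i = η

variable {ι : Type*} [Fintype ι] {ξ : ι → E}

theorem IsFrame.φ_eq_sum (hξ : IsFrame A ξ) (a : A) :
    C.φ a = ∑ i, rankOneOp A (C.φ a (ξ i)) (ξ i) := by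
  ext η
  conv_lhs => rw [← hξ η, map_sum]
  rw [sum_apply]
  exact Finset.sum_congr rfl fun i _ => C.φ_smul _ _ _

/-- With a finite frame every left multiplication is compact, so Katsura's ideal is everything as
soon as the structure map is injective. -/
theorem IsFrame.mem_katsuraIdeal (hξ : IsFrame A ξ) (hφ : ∀ a, C.φ a = 0 → a = 0) (a : A) :
    a ∈ C.katsuraIdeal := by
  refine ⟨?_, fun b hb => by rw [hφ b hb, mul_zero]⟩
  rw [hξ.φ_eq_sum C a]
  exact Submodule.sum_mem _ fun i _ => rankOneOp_mem A _ _

variable {C}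

theorem Representation.continuous_t {B : Type w} [NonUnitalCStarAlgebra B]
    (ρ : C.Representation B) : Continuous ρ.t :=
  AddMonoidHomClass.continuous_of_bound ρ.t 1 fun ξ => by rw [one_mul]; exact ρ.norm_t_le ξ

/-- For a module with a finite frame `ξ`, the map `K(E) → B` attached to a representation is
`T ↦ ∑ᵢ t(T ξᵢ) t(ξᵢ)⋆`, so that the representation is covariant if `∑ᵢ t(ξᵢ) t(ξᵢ)⋆` is a right
unit for the coefficients. -/
theorem IsFrame.isCovariant (hξ : IsFrame A ξ) {B : Type w} [NonUnitalCStarAlgebra B]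
    (ρ : C.Representation B) (h : ∀ a, ρ.π a * ∑ i, ρ.t (ξ i) * star (ρ.t (ξ i)) = ρ.π a) :
    ρ.IsCovariant := by
  let ψ₀ : (E →L[ℂ] E) →L[ℂ] B := ∑ i,
    ((ContinuousLinearMap.mul ℂ B).flip (star (ρ.t (ξ i)))).comp
      ((⟨ρ.t, ρ.continuous_t⟩ : E →L[ℂ] B).comp (ContinuousLinearMap.apply ℂ E (ξ i)))
  have hψ : ∀ T : E →L[ℂ] E, ψ₀ T = ∑ i, ρ.t (T (ξ i)) * star (ρ.t (ξ i)) := fun T => by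
    simp [ψ₀]
  refine ⟨ψ₀.comp (compactOps A E).subtypeL, fun ζ η => ?_, fun a ha => ?_⟩
  · change ψ₀ (rankOneOp A ζ η) = _
    rw [hψ]
    conv_rhs => rw [← hξ η, map_sum, star_sum, Finset.mul_sum]
    refine Finset.sum_congr rfl fun i _ => ?_
    change ρ.t ((inner A η (ξ i) : A) • ζ) * _ = _
    rw [ρ.t_smul, ρ.t_smul, star_mul, ← map_star ρ.π, CStarModule.star_inner, mul_assoc]
  · change ρ.π a = ψ₀ (C.φ a)
    rw [hψ]
    simp_rw [← ρ.left_mul, mul_assoc]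
    rw [← Finset.mul_sum, h]

/-- Covariance for a coefficient acting as a finite sum of rank one operators. -/
theorem Representation.IsCovariant.π_eq_sum {B : Type w} [NonUnitalCStarAlgebra B]
    {ρ : C.Representation B} (hρ : ρ.IsCovariant) {a : A} (ha : a ∈ C.katsuraIdeal)
    {η ζ : ι → E} (h : C.φ a = ∑ i, rankOneOp A (η i) (ζ i)) :
    ρ.π a = ∑ i, ρ.t (η i) * star (ρ.t (ζ i)) := by
  obtain ⟨ψ, h1, h2⟩ := hρ
  rw [h2 a ha]
  simp_rw [← h1]
  rw [← map_sum]
  congr 1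
  apply Subtype.ext
  simpa using h

/-! ### The universal covariant representation -/

variable (C)

/-- The universal representation `(π_u, t_u)` on the Cuntz–Pimsner algebra. -/
def universalRep : C.Representation C.CuntzPimsner where
  π := C.coeff
  t := C.creation
  inner_eq ξ η := by
    apply Subtype.ext
    ext i
    exact i.ρ.inner_eq ξ η
  left_mul a ξ := by
    apply Subtype.ext
    ext i
    exact i.ρ.left_mul a ξ

theorem coeff_inner (ξ η : E) :
    C.coeff (inner A ξ η) = star (C.creation ξ) * C.creation η := C.universalRep.inner_eq ξ η

theorem coeff_mul_creation (a : A) (ξ : E) :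
    C.coeff a * C.creation ξ = C.creation (C.φ a ξ) := C.universalRep.left_mul a ξ

theorem creation_smul (a : A) (ξ : E) :
    C.creation (a • ξ) = C.creation ξ * C.coeff a := C.universalRep.t_smul a ξ

theorem coeff_eq_sum {a : A} (ha : a ∈ C.katsuraIdeal) {η ζ : ι → E}
    (h : C.φ a = ∑ i, rankOneOp A (η i) (ζ i)) :
    C.coeff a = ∑ i, C.creation (η i) * star (C.creation (ζ i)) := by
  apply Subtype.ext
  have h1 : ((∑ i, C.creation (η i) * star (C.creation (ζ i)) : C.CuntzPimsner)).1 =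
      ∑ i, C.prodT (η i) * star (C.prodT (ζ i)) :=
    map_sum (NonUnitalStarSubalgebraClass.subtype C.cuntzPimsnerSubalgebra) _ _
  rw [h1]
  ext i
  rw [lp.coeFn_sum, Finset.sum_apply]
  exact i.covariant.π_eq_sum ha h

/-- The homomorphism of the Cuntz–Pimsner algebra attached to a covariant representation. -/
def eval (i : C.CovariantRep) : C.CuntzPimsner →⋆ₙₐ[ℂ] i.B where
  toFun x := x.1 i
  map_smul' _ _ := rfl
  map_zero' := rfl
  map_add' _ _ := rfl
  map_mul' _ _ := rfl
  map_star' _ := rfl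

/-- The Cuntz–Pimsner algebra is generated by the images of `π_u` and `t_u`: a closed
⋆-subalgebra containing them is everything. -/
theorem mem_of_isClosed (S : NonUnitalStarSubalgebra ℂ C.CuntzPimsner)
    (hS : IsClosed (S : Set C.CuntzPimsner)) (h1 : ∀ a, C.coeff a ∈ S)
    (h2 : ∀ ξ, C.creation ξ ∈ S) (x : C.CuntzPimsner) : x ∈ S := by
  have hcl : IsClosed (C.cuntzPimsnerSubalgebra : Set C.RepProduct) :=
    NonUnitalStarSubalgebra.isClosed_topologicalClosure _
  have h : C.cuntzPimsnerSubalgebra ≤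
      S.map (NonUnitalStarSubalgebraClass.subtype C.cuntzPimsnerSubalgebra) := by
    refine NonUnitalStarSubalgebra.topologicalClosure_minimal _ ?_ ?_
    · rw [NonUnitalStarAlgebra.adjoin_le_iff]
      rintro _ (⟨a, rfl⟩ | ⟨ξ, rfl⟩)
      · exact ⟨_, h1 a, rfl⟩
      · exact ⟨_, h2 ξ, rfl⟩
    · exact hcl.isClosedEmbedding_subtypeVal.isClosedMap _ hS
  obtain ⟨y, hy, hxy⟩ := h x.2
  rwa [← Subtype.ext hxy]

/-! ### The gauge expectation as a bounded linear map -/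

theorem gauge_norm_le (z : Circle) (a : C.CuntzPimsner) : ‖C.gauge z a‖ ≤ ‖a‖ :=
  NonUnitalStarAlgHom.norm_apply_le (C.gauge z) a

theorem continuous_gauge (a : C.CuntzPimsner) : Continuous fun z => C.gauge z a := by
  let S : NonUnitalStarSubalgebra ℂ C.CuntzPimsner :=
    { carrier := {a | Continuous fun z => C.gauge z a}
      add_mem' := fun {a b} ha hb => by
        simp only [Set.mem_ofPred_eq, map_add] at *; exact ha.add hb
      zero_mem' := by simp only [Set.mem_ofPred_eq, map_zero]; exact continuous_const
      mul_mem' := fun {a b} ha hb => by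
        simp only [Set.mem_ofPred_eq, map_mul] at *; exact ha.mul hb
      smul_mem' := fun c a ha => by
        simp only [Set.mem_ofPred_eq, map_smul] at *; exact ha.const_smul c
      star_mem' := fun {a} ha => by
        simp only [Set.mem_ofPred_eq, map_star] at *; exact ha.star }
  refine C.mem_of_isClosed S ?_ (fun a => ?_) (fun ξ => ?_) a
  -- The gauge automorphisms are contractive, so orbit maps of nearby elements are uniformly close.
  · refine isClosed_of_closure_subset fun a ha => ?_
    change Continuous fun z => C.gauge z a
    refine continuous_of_uniform_approx_of_continuous fun U hU => ?_
    obtain ⟨ε, hε, hεU⟩ := Metric.mem_uniformity_dist.1 hU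
    obtain ⟨b, hb, hab⟩ := Metric.mem_closure_iff.1 ha ε hε
    refine ⟨fun z => C.gauge z b, hb, fun z => hεU (lt_of_le_of_lt ?_ hab)⟩
    rw [dist_eq_norm, dist_eq_norm, ← map_sub]
    exact C.gauge_norm_le z _
  · change Continuous fun _ : Circle => C.coeff a
    exact continuous_const
  · change Continuous fun z => C.gauge z (C.creation ξ)
    simp only [gauge_creation]
    exact continuous_subtype_val.smul continuous_const

theorem intervalIntegrable_gauge (a : C.CuntzPimsner) (r s : ℝ) :
    IntervalIntegrable (fun s : ℝ => C.gauge (Circle.exp (2 * Real.pi * s)) a)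
      MeasureTheory.volume r s :=
  ((C.continuous_gauge a).comp (Circle.exp.continuous.comp
    (continuous_const.mul continuous_id))).intervalIntegrable _ _

theorem gaugeExpectation_add (a b : C.CuntzPimsner) :
    C.gaugeExpectation (a + b) = C.gaugeExpectation a + C.gaugeExpectation b := by
  simp only [gaugeExpectation, map_add]
  exact intervalIntegral.integral_add (C.intervalIntegrable_gauge a 0 1)
    (C.intervalIntegrable_gauge b 0 1)

theorem gaugeExpectation_smul (c : ℂ) (a : C.CuntzPimsner) :
    C.gaugeExpectation (c • a) = c • C.gaugeExpectation a := by
  simp only [gaugeExpectation, map_smul]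
  exact intervalIntegral.integral_smul c _

theorem norm_gaugeExpectation_le (a : C.CuntzPimsner) : ‖C.gaugeExpectation a‖ ≤ ‖a‖ := by
  have := intervalIntegral.norm_integral_le_of_norm_le_const (a := 0) (b := 1) (C := ‖a‖)
    (f := fun s : ℝ => C.gauge (Circle.exp (2 * Real.pi * s)) a)
    fun s _ => C.gauge_norm_le _ a
  simpa [gaugeExpectation] using this

theorem gaugeExpectation_star (a : C.CuntzPimsner) :
    C.gaugeExpectation (star a) = star (C.gaugeExpectation a) := by
  simp only [gaugeExpectation, map_star]
  exact ((starL' ℝ : C.CuntzPimsner ≃L[ℝ] C.CuntzPimsner) :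
    C.CuntzPimsner →L[ℝ] C.CuntzPimsner).intervalIntegral_comp_comm
      (C.intervalIntegrable_gauge a 0 1)

/-- The gauge expectation as a bounded linear map. -/
def gaugeExpectationL : C.CuntzPimsner →L[ℂ] C.CuntzPimsner :=
  LinearMap.mkContinuous
    { toFun := C.gaugeExpectation
      map_add' := C.gaugeExpectation_add
      map_smul' := C.gaugeExpectation_smul } 1 fun a => by
    rw [one_mul]; exact C.norm_gaugeExpectation_le a

theorem gaugeExpectation_coeff (a : A) : C.gaugeExpectation (C.coeff a) = C.coeff a := by
  simp [gaugeExpectation, gauge_coeff]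

/-- The integral of `z ^ n` over the circle vanishes for `n ≠ 0`. -/
theorem gaugeExpectation_eq_zero {a : C.CuntzPimsner} {n : ℤ} (hn : n ≠ 0)
    (ha : ∀ z : Circle, C.gauge z a = ((z : ℂ) ^ n) • a) : C.gaugeExpectation a = 0 := by
  simp only [gaugeExpectation, ha]
  rw [intervalIntegral.integral_smul_const]
  convert zero_smul ℂ a using 2
  have h1 : ∀ s : ℝ, ((Circle.exp (2 * Real.pi * s) : Circle) : ℂ) ^ n =
      Complex.exp ((2 * Real.pi * n * Complex.I) * s) := fun s => by
    rw [Circle.coe_exp, ← Complex.exp_int_mul]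
    congr 1; push_cast; ring
  simp only [h1]
  have hc : (2 * Real.pi * n * Complex.I : ℂ) ≠ 0 := by
    simp [Real.pi_ne_zero, hn, Complex.I_ne_zero]
  rw [integral_exp_mul_complex hc]
  have : Complex.exp (2 * Real.pi * n * Complex.I * (1 : ℝ)) = 1 := by
    rw [Complex.exp_eq_one_iff]
    exact ⟨n, by push_cast; ring⟩
  rw [this]; simp

end CStarCorrespondence

/-! ### Faithfulness of the gauge expectation -/

namespace CStarCorrespondence

variable {A : Type u} {E : Type v} [CommCStarAlgebra A] [PartialOrder A] [StarOrderedRing A]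
  [NormedAddCommGroup E] [NormedSpace ℂ E] [CompleteSpace E] [SMul A E] [CStarModule A E]
  (C : CStarCorrespondence A E)

theorem gauge_inv_gauge (z : Circle) (a : C.CuntzPimsner) : C.gauge z⁻¹ (C.gauge z a) = a := by
  let S : NonUnitalStarSubalgebra ℂ C.CuntzPimsner :=
    { carrier := {a | C.gauge z⁻¹ (C.gauge z a) = a}
      add_mem' := fun {a b} ha hb => by
        simp only [Set.mem_ofPred_eq, map_add] at *; rw [ha, hb]
      zero_mem' := by simp only [Set.mem_ofPred_eq, map_zero]
      mul_mem' := fun {a b} ha hb => by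
        simp only [Set.mem_ofPred_eq, map_mul] at *; rw [ha, hb]
      smul_mem' := fun c a ha => by
        simp only [Set.mem_ofPred_eq, map_smul] at *; rw [ha]
      star_mem' := fun {a} ha => by
        simp only [Set.mem_ofPred_eq, map_star] at *; rw [ha] }
  have hc : ∀ z, Continuous (C.gauge z) := fun z =>
    AddMonoidHomClass.continuous_of_bound (C.gauge z) 1 fun x => by
      rw [one_mul]; exact C.gauge_norm_le z x
  refine C.mem_of_isClosed S ?_ (fun a => rfl) (fun ξ => ?_) a
  · exact isClosed_eq ((hc _).comp (hc _)) continuous_id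
  · change C.gauge z⁻¹ (C.gauge z (C.creation ξ)) = C.creation ξ
    rw [gauge_creation, map_smul, gauge_creation, smul_smul, ← Circle.coe_mul]
    simp

/-- Integrals of non-negative functions in a C⋆-algebra are non-negative; here an element is
non-negative if it is of the form `s⋆ s`. -/
theorem exists_integral_eq_star_mul_self {B : Type w} [NonUnitalCStarAlgebra B] {g : ℝ → B}
    (a b : ℝ) (hab : a ≤ b) :
    ∃ s, ∫ t in a..b, star (g t) * g t = star s * s := by
  let _ := CStarAlgebra.spectralOrder B
  have := CStarAlgebra.spectralOrderedRing B
  rw [← CStarAlgebra.nonneg_iff_eq_star_mul_self, intervalIntegral.integral_of_le hab]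
  exact MeasureTheory.integral_nonneg fun t => star_mul_self_nonneg _

theorem exists_gaugeExpectation_eq_star_mul_self (a : C.CuntzPimsner) :
    ∃ s, C.gaugeExpectation (star a * a) = star s * s := by
  simp only [gaugeExpectation, map_mul, map_star]
  exact exists_integral_eq_star_mul_self _ _ zero_le_one

/-- A continuous positive function with vanishing integral vanishes: its integrals over `[0, t]` and
`[t, 1]` are positive with sum zero, so the first is constantly zero in `t`, and it has the function
as its derivative. -/
theorem eq_zero_of_integral_eq_zero {B : Type w} [NonUnitalCStarAlgebra B] {g : ℝ → B}
    (hg : Continuous g) (h : ∫ t in (0 : ℝ)..1, star (g t) * g t = 0) {t : ℝ}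
    (ht : t ∈ Set.Ioo (0 : ℝ) 1) : g t = 0 := by
  have hgg : Continuous fun t => star (g t) * g t := hg.star.mul hg
  have hzero : ∀ t ∈ Set.Ioo (0 : ℝ) 1, ∫ r in (0 : ℝ)..t, star (g r) * g r = 0 := by
    intro t ht
    let _ := CStarAlgebra.spectralOrder B
    have := CStarAlgebra.spectralOrderedRing B
    obtain ⟨p, hp⟩ := exists_integral_eq_star_mul_self (g := g) 0 t ht.1.le
    obtain ⟨q, hq⟩ := exists_integral_eq_star_mul_self (g := g) t 1 ht.2.le
    rw [← intervalIntegral.integral_add_adjacent_intervals (hgg.intervalIntegrable 0 t)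
      (hgg.intervalIntegrable t 1), hp, hq] at h
    rw [hp]
    refine le_antisymm ?_ (star_mul_self_nonneg p)
    rw [eq_neg_of_add_eq_zero_left h]
    exact neg_nonpos.2 (star_mul_self_nonneg q)
  have h1 : HasDerivAt (fun t => ∫ r in (0 : ℝ)..t, star (g r) * g r) (star (g t) * g t) t :=
    intervalIntegral.integral_hasDerivAt_right (hgg.intervalIntegrable 0 t)
      hgg.stronglyMeasurable.stronglyMeasurableAtFilter hgg.continuousAt
  have h2 : HasDerivAt (fun t => ∫ r in (0 : ℝ)..t, star (g r) * g r) 0 t := by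
    refine (hasDerivAt_const t (0 : B)).congr_of_eventuallyEq ?_
    filter_upwards [Ioo_mem_nhds ht.1 ht.2] with r hr using hzero r hr
  exact CStarRing.star_mul_self_eq_zero_iff _ |>.1 (h1.unique h2)

/-- The gauge expectation is faithful. -/
theorem eq_zero_of_gaugeExpectation_eq_zero {a : C.CuntzPimsner}
    (h : C.gaugeExpectation (star a * a) = 0) : a = 0 := by
  simp only [gaugeExpectation, map_mul, map_star] at h
  have := eq_zero_of_integral_eq_zero ((C.continuous_gauge a).comp (Circle.exp.continuous.comp
    (continuous_const.mul continuous_id))) h (t := 1 / 2) (by norm_num)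
  rw [← C.gauge_inv_gauge _ a]
  exact (congrArg _ this).trans (map_zero _)

/-! ### Correspondences of rank one -/

/-- The properties of the correspondence of a line bundle on which the structure of its
Cuntz–Pimsner algebra rests: the structure map is unital, products `t(ξ) t(η)⋆` are coefficients,
and the coefficient map is injective and reflects positivity. -/
structure IsRankOne : Prop where
  φ_one : ∀ ξ, C.φ 1 ξ = ξ
  creation_mul_star : ∀ ξ η, ∃ a, C.coeff a = C.creation ξ * star (C.creation η)
  injective : Function.Injective C.coeff
  nonneg : ∀ a s, C.coeff a = star s * s → 0 ≤ a

theorem creation_mul_coeff_one (ξ : E) : C.creation ξ * C.coeff 1 = C.creation ξ := by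
  rw [← creation_smul]
  congr 1
  exact CStarModule.smul_ext_inner A fun z => by
    rw [CStarModule.inner_op_smul_right, one_mul]

theorem coeff_one_unit (hφ : ∀ ξ, C.φ 1 ξ = ξ) (a : C.CuntzPimsner) :
    C.coeff 1 * a = a ∧ a * C.coeff 1 = a := by
  have h1 : star (C.coeff 1) = C.coeff 1 := by rw [← map_star, star_one]
  let S : NonUnitalStarSubalgebra ℂ C.CuntzPimsner :=
    { carrier := {a | C.coeff 1 * a = a ∧ a * C.coeff 1 = a}
      add_mem' := fun {a b} ha hb => by
        simp only [Set.mem_ofPred_eq, mul_add, add_mul] at *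
        rw [ha.1, hb.1, ha.2, hb.2]; exact ⟨rfl, rfl⟩
      zero_mem' := by simp
      mul_mem' := fun {a b} ha hb => ⟨by rw [← mul_assoc, ha.1], by rw [mul_assoc, hb.2]⟩
      smul_mem' := fun c a ha => ⟨by rw [mul_smul_comm, ha.1], by rw [smul_mul_assoc, ha.2]⟩
      star_mem' := fun {a} ha =>
        ⟨by rw [← h1, ← star_mul, ha.2], by rw [← h1, ← star_mul, ha.1]⟩ }
  refine C.mem_of_isClosed S ?_ (fun f => ?_) (fun ξ => ?_) a
  · exact (isClosed_eq (continuous_const.mul continuous_id) continuous_id).inter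
      (isClosed_eq (continuous_id.mul continuous_const) continuous_id)
  · exact ⟨by rw [← map_mul, one_mul], by rw [← map_mul, mul_one]⟩
  · exact ⟨by rw [coeff_mul_creation, hφ], C.creation_mul_coeff_one ξ⟩

/-- The words `t(ξ₁) ⋯ t(ξₙ) π(a)` (of degree `n ≥ 0`) and `t(ξ₁)⋆ ⋯ t(ξₙ)⋆ π(a)` (of degree
`-n ≤ 0`). -/
inductive IsWord : ℤ → C.CuntzPimsner → Prop
  | coeff (a : A) : IsWord 0 (C.coeff a)
  | creation (ξ : E) {n : ℤ} {w : C.CuntzPimsner} (hn : 0 ≤ n) (hw : IsWord n w) :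
      IsWord (n + 1) (C.creation ξ * w)
  | star_creation (ξ : E) {n : ℤ} {w : C.CuntzPimsner} (hn : n ≤ 0) (hw : IsWord n w) :
      IsWord (n - 1) (star (C.creation ξ) * w)

variable {C}

theorem IsWord.gauge {n : ℤ} {w : C.CuntzPimsner} (h : C.IsWord n w) (z : Circle) :
    C.gauge z w = ((z : ℂ) ^ n) • w := by
  have hz : (z : ℂ) ≠ 0 := z.coe_ne_zero
  induction h with
  | coeff a => simp [gauge_coeff]
  | creation ξ hn hw ih =>
    rw [map_mul, gauge_creation, ih, smul_mul_smul_comm, zpow_add_one₀ hz, mul_comm (z : ℂ)]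
  | star_creation ξ hn hw ih =>
    rw [map_mul, map_star, gauge_creation, ih, star_smul, smul_mul_smul_comm, zpow_sub_one₀ hz,
      mul_comm (star (z : ℂ)), ← Circle.coe_inv, Circle.coe_inv_eq_conj]
    rfl

theorem IsWord.coeff_mul {n : ℤ} {w : C.CuntzPimsner} (h : C.IsWord n w) (a : A) :
    C.IsWord n (C.coeff a * w) := by
  cases h with
  | coeff b => rw [← map_mul]; exact .coeff _
  | creation ξ hn hw => rw [← mul_assoc, coeff_mul_creation]; exact .creation _ hn hw
  | star_creation ξ hn hw =>
    have : C.coeff a * star (C.creation ξ) = star (C.creation (star a • ξ)) := by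
      rw [creation_smul, star_mul, ← map_star C.coeff, star_star]
    rw [← mul_assoc, this]
    exact .star_creation _ hn hw

theorem IsWord.exists_coeff {n : ℤ} {w : C.CuntzPimsner} (h : C.IsWord n w) (hn : n = 0) :
    ∃ a, w = C.coeff a := by
  cases h with
  | coeff a => exact ⟨a, rfl⟩
  | creation => omega
  | star_creation => omega

theorem IsWord.exists_star_creation {n : ℤ} {w : C.CuntzPimsner} (h : C.IsWord n w)
    (hn : n = -1) : ∃ ξ, w = star (C.creation ξ) := by
  cases h with
  | coeff a => omega
  | creation => omega
  | star_creation ξ _ hw =>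
    obtain ⟨a, rfl⟩ := hw.exists_coeff (by omega)
    refine ⟨C.φ (star a) ξ, ?_⟩
    rw [← coeff_mul_creation, star_mul, ← map_star C.coeff, star_star]

theorem IsWord.star_creation_mul {n : ℤ} {w : C.CuntzPimsner} (h : C.IsWord n w) (ξ : E) :
    C.IsWord (n - 1) (star (C.creation ξ) * w) := by
  by_cases hn : n ≤ 0
  · exact .star_creation ξ hn h
  · cases h with
    | coeff => omega
    | creation η _ hw =>
      rw [← mul_assoc, ← coeff_inner, add_sub_cancel_right]
      exact hw.coeff_mul _
    | star_creation => omega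

namespace IsRankOne

variable (hC : C.IsRankOne)
include hC

/-- Multiplying a word `t(η)⋆ w` of negative degree by `t(ξ)` cancels the first letter, as
`t(ξ) t(η)⋆` is a coefficient. -/
theorem creation_mul {n : ℤ} {w : C.CuntzPimsner} (h : C.IsWord n w) (ξ : E) :
    C.IsWord (n + 1) (C.creation ξ * w) := by
  by_cases hn : 0 ≤ n
  · exact .creation ξ hn h
  · cases h with
    | coeff => omega
    | creation => omega
    | star_creation η _ hw =>
      obtain ⟨a, ha⟩ := hC.creation_mul_star ξ η
      rw [← mul_assoc, ← ha, sub_add_cancel]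
      exact hw.coeff_mul a

/-- The words span a dense subspace: the closure of their span is a left ideal containing the unit
`π(1)`. -/
theorem closure_span_isWord :
    closure (Submodule.span ℂ {w | ∃ n, C.IsWord n w} : Set C.CuntzPimsner) = Set.univ := by
  let M := (Submodule.span ℂ {w | ∃ n, C.IsWord n w}).topologicalClosure
  have key : ∀ g : C.CuntzPimsner, (∀ n w, C.IsWord n w → ∃ m, C.IsWord m (g * w)) →
      ∀ w ∈ M, g * w ∈ M := by
    intro g hg w hw
    have hM : M ≤ M.comap (LinearMap.mulLeft ℂ g) := by
      refine Submodule.topologicalClosure_minimal _ ?_ ?_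
      · rw [Submodule.span_le]
        rintro w ⟨n, hw⟩
        exact Submodule.le_topologicalClosure _ (Submodule.subset_span (hg n w hw))
      · exact (Submodule.isClosed_topologicalClosure _).preimage
          (continuous_const.mul continuous_id)
    exact hM hw
  let S : NonUnitalStarSubalgebra ℂ C.CuntzPimsner :=
    { carrier := {a | ∀ w ∈ M, a * w ∈ M ∧ star a * w ∈ M}
      add_mem' := fun {a b} ha hb w hw => by
        rw [star_add, add_mul, add_mul]
        exact ⟨M.add_mem (ha w hw).1 (hb w hw).1, M.add_mem (ha w hw).2 (hb w hw).2⟩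
      zero_mem' := fun w hw => by simp
      mul_mem' := fun {a b} ha hb w hw => by
        rw [star_mul, mul_assoc, mul_assoc]
        exact ⟨(ha _ (hb w hw).1).1, (hb _ (ha w hw).2).2⟩
      smul_mem' := fun c a ha w hw => by
        rw [star_smul, smul_mul_assoc, smul_mul_assoc]
        exact ⟨M.smul_mem _ (ha w hw).1, M.smul_mem _ (ha w hw).2⟩
      star_mem' := fun {a} ha w hw => by
        rw [star_star]; exact (ha w hw).symm }
  have hMc : IsClosed (M : Set C.CuntzPimsner) := Submodule.isClosed_topologicalClosure _
  have hS : ∀ a, a ∈ S := by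
    refine C.mem_of_isClosed S ?_ (fun f => ?_) (fun ξ => ?_)
    · have : (S : Set C.CuntzPimsner) =
          ⋂ w ∈ M, {a | a * w ∈ M} ∩ {a | star a * w ∈ M} := by
        ext a; simp [S]; rfl
      rw [this]
      exact isClosed_biInter fun w _ =>
        (hMc.preimage (continuous_id.mul continuous_const)).inter
          (hMc.preimage (continuous_star.mul continuous_const))
    · exact fun w hw => ⟨key _ (fun n w h => ⟨n, h.coeff_mul f⟩) w hw,
        key _ (fun n w h => ⟨n, by rw [← map_star]; exact h.coeff_mul _⟩) w hw⟩
    · exact fun w hw => ⟨key _ (fun n w h => ⟨_, hC.creation_mul h ξ⟩) w hw,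
        key _ (fun n w h => ⟨_, h.star_creation_mul ξ⟩) w hw⟩
  refine Set.eq_univ_of_forall fun a => ?_
  rw [← (C.coeff_one_unit hC.φ_one a).2]
  exact (hS a _ (Submodule.le_topologicalClosure _
    (Submodule.subset_span ⟨0, IsWord.coeff 1⟩))).1

/-- Density of the words: a closed subspace containing all words is everything. -/
theorem mem_of_isWord_mem (M : Submodule ℂ C.CuntzPimsner)
    (hM : IsClosed (M : Set C.CuntzPimsner)) (h : ∀ n w, C.IsWord n w → w ∈ M)
    (a : C.CuntzPimsner) : a ∈ M := by
  have h1 : closure (Submodule.span ℂ {w | ∃ n, C.IsWord n w} : Set C.CuntzPimsner) ⊆ M :=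
    closure_minimal (Submodule.span_le.2 fun w ⟨n, hw⟩ => h n w hw) hM
  rw [hC.closure_span_isWord] at h1
  exact h1 (Set.mem_univ a)

/-- The gauge expectation kills the words of non-zero degree and fixes those of degree zero, which
are coefficients. -/
theorem gaugeExpectation_mem_range (a : C.CuntzPimsner) :
    C.gaugeExpectation a ∈ Set.range C.coeff := by
  have hcl : IsClosed (Set.range C.coeff) :=
    (NonUnitalStarAlgHom.isometry C.coeff hC.injective).isClosedEmbedding.isClosed_range
  refine hC.mem_of_isWord_mem
    ((LinearMap.range (C.coeff : A →ₗ[ℂ] C.CuntzPimsner)).comap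
      (C.gaugeExpectationL : C.CuntzPimsner →ₗ[ℂ] C.CuntzPimsner))
    (hcl.preimage C.gaugeExpectationL.continuous) (fun n w hw => ?_) a
  change C.gaugeExpectation w ∈ Set.range C.coeff
  by_cases hn : n = 0
  · obtain ⟨f, rfl⟩ := hw.exists_coeff hn
    exact ⟨f, (C.gaugeExpectation_coeff f).symm⟩
  · exact ⟨0, by rw [map_zero, gaugeExpectation_eq_zero C hn hw.gauge]⟩

/-- The gauge expectation, regarded as a map onto the coefficient algebra. -/
def expectation : C.CuntzPimsner →L[ℂ] A :=
  LinearMap.mkContinuous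
    { toFun := fun a => (hC.gaugeExpectation_mem_range a).choose
      map_add' := fun a b => hC.injective <| by
        rw [map_add, (hC.gaugeExpectation_mem_range _).choose_spec,
          (hC.gaugeExpectation_mem_range _).choose_spec,
          (hC.gaugeExpectation_mem_range _).choose_spec, gaugeExpectation_add]
      map_smul' := fun c a => hC.injective <| by
        rw [map_smul, (hC.gaugeExpectation_mem_range _).choose_spec,
          (hC.gaugeExpectation_mem_range _).choose_spec, gaugeExpectation_smul]
        rfl } 1 fun a => by
    rw [one_mul]
    refine le_trans (le_of_eq ?_) (C.norm_gaugeExpectation_le a)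
    rw [← (hC.gaugeExpectation_mem_range a).choose_spec]
    exact (NonUnitalStarAlgHom.norm_map C.coeff hC.injective _).symm

theorem coeff_expectation (a : C.CuntzPimsner) :
    C.coeff (hC.expectation a) = C.gaugeExpectation a :=
  (hC.gaugeExpectation_mem_range a).choose_spec

theorem expectation_coeff (f : A) : hC.expectation (C.coeff f) = f :=
  hC.injective <| by rw [coeff_expectation, gaugeExpectation_coeff]

theorem norm_expectation_le (a : C.CuntzPimsner) : ‖hC.expectation a‖ ≤ ‖a‖ := by
  rw [← NonUnitalStarAlgHom.norm_map C.coeff hC.injective, coeff_expectation]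
  exact C.norm_gaugeExpectation_le a

theorem expectation_star (a : C.CuntzPimsner) :
    hC.expectation (star a) = star (hC.expectation a) :=
  hC.injective <| by
    rw [map_star C.coeff, coeff_expectation, coeff_expectation, gaugeExpectation_star]

theorem expectation_nonneg (a : C.CuntzPimsner) : 0 ≤ hC.expectation (star a * a) := by
  obtain ⟨s, hs⟩ := C.exists_gaugeExpectation_eq_star_mul_self a
  exact hC.nonneg _ s (by rw [coeff_expectation, hs])

theorem eq_zero_of_expectation_eq_zero {a : C.CuntzPimsner}
    (h : hC.expectation (star a * a) = 0) : a = 0 :=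
  C.eq_zero_of_gaugeExpectation_eq_zero (by rw [← hC.coeff_expectation, h, map_zero])

theorem expectation_eq_zero {n : ℤ} (hn : n ≠ 0) {a : C.CuntzPimsner}
    (h : ∀ z : Circle, C.gauge z a = ((z : ℂ) ^ n) • a) : hC.expectation a = 0 :=
  hC.injective <| by rw [coeff_expectation, map_zero, gaugeExpectation_eq_zero C hn h]

/-- A state `L` of the coefficient algebra with `L (t(ξ) t(η)⋆) = L (t(η)⋆ t(ξ))` extends along the
expectation to a trace. It suffices to compare `a b` and `b a` for a generator `a` and a word `b`,
and both have expectation zero unless the degrees of `a` and `b` add up to zero. -/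
theorem isTracialState_comp_expectation [Nontrivial A] (L : A →L[ℂ] ℂ)
    (hL : ∀ f, 0 ≤ f → 0 ≤ L f) (hLn : ∀ f, ‖L f‖ ≤ ‖f‖) (hL1 : L 1 = 1)
    (hLs : ∀ f, L (star f) = star (L f))
    (hLt : ∀ ξ η f, C.coeff f = C.creation ξ * star (C.creation η) → L f = L (inner A η ξ)) :
    IsTracialState (L.comp hC.expectation) := by
  set τ := L.comp hC.expectation with hτ
  have hτc : ∀ f, τ (C.coeff f) = L f := fun f => by
    rw [hτ, ContinuousLinearMap.comp_apply, expectation_coeff]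
  have hτs : ∀ a, τ (star a) = star (τ a) := fun a => by
    rw [hτ, ContinuousLinearMap.comp_apply, expectation_star, hLs]; rfl
  -- Elements of non-zero degree have trace zero.
  have hτ0 : ∀ (n : ℤ) (a : C.CuntzPimsner), n ≠ 0 →
      (∀ z : Circle, C.gauge z a = ((z : ℂ) ^ n) • a) → τ a = 0 := fun n a hn ha => by
    rw [hτ, ContinuousLinearMap.comp_apply, hC.expectation_eq_zero hn ha, map_zero]
  have hgen : ∀ ξ η, τ (C.creation ξ * star (C.creation η)) =
      τ (star (C.creation η) * C.creation ξ) := fun ξ η => by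
    obtain ⟨f, hf⟩ := hC.creation_mul_star ξ η
    rw [← hf, ← coeff_inner, hτc, hτc, hLt ξ η f hf]
  -- An element which commutes with all words under `τ` commutes with everything.
  have hext : ∀ g : C.CuntzPimsner, (∀ n w, C.IsWord n w → τ (g * w) = τ (w * g)) →
      ∀ b, τ (g * b) = τ (b * g) := by
    intro g hg b
    refine hC.mem_of_isWord_mem (LinearMap.eqLocus
      ((τ : C.CuntzPimsner →ₗ[ℂ] ℂ).comp (LinearMap.mulLeft ℂ g))
      ((τ : C.CuntzPimsner →ₗ[ℂ] ℂ).comp (LinearMap.mulRight ℂ g))) ?_ hg b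
    exact isClosed_eq (τ.continuous.comp (continuous_const.mul continuous_id))
      (τ.continuous.comp (continuous_id.mul continuous_const))
  let S : NonUnitalStarSubalgebra ℂ C.CuntzPimsner :=
    { carrier := {a | ∀ b, τ (a * b) = τ (b * a)}
      add_mem' := fun {a b} ha hb c => by
        rw [add_mul, mul_add, map_add, map_add, ha, hb]
      zero_mem' := fun b => by simp
      mul_mem' := fun {a b} ha hb c => by
        rw [mul_assoc, ha, mul_assoc, hb, mul_assoc]
      smul_mem' := fun c a ha b => by
        rw [smul_mul_assoc, mul_smul_comm, map_smul, map_smul, ha]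
      star_mem' := fun {a} ha b => by
        rw [← star_star (star a * b), ← star_star (b * star a), hτs, hτs (star (b * star a))]
        simp only [star_mul, star_star]
        rw [ha] }
  have htr : ∀ a, a ∈ S := by
    refine C.mem_of_isClosed S ?_ (fun f => ?_) (fun ξ => ?_)
    · have : (S : Set C.CuntzPimsner) = ⋂ b, {a | τ (a * b) = τ (b * a)} := by
        ext a; simp [S]; rfl
      rw [this]
      exact isClosed_iInter fun b =>
        isClosed_eq (τ.continuous.comp (continuous_id.mul continuous_const))
          (τ.continuous.comp (continuous_const.mul continuous_id))
    · refine hext _ fun n w hw => ?_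
      by_cases hn : n = 0
      · obtain ⟨g, rfl⟩ := hw.exists_coeff hn
        rw [← map_mul, mul_comm, map_mul]
      · rw [hτ0 n _ hn (hw.coeff_mul f).gauge, hτ0 n _ hn fun z => by
          rw [map_mul, gauge_coeff, hw.gauge, smul_mul_assoc]]
    · refine hext _ fun n w hw => ?_
      by_cases hn : n = -1
      · obtain ⟨η, rfl⟩ := hw.exists_star_creation hn
        exact hgen ξ η
      · rw [hτ0 (n + 1) _ (by omega) (hC.creation_mul hw ξ).gauge,
          hτ0 (n + 1) _ (by omega) fun z => by
            rw [map_mul, gauge_creation, hw.gauge, smul_mul_smul_comm,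
              zpow_add_one₀ z.coe_ne_zero]]
  refine ⟨fun a => hL _ (hC.expectation_nonneg a), le_antisymm ?_ ?_, fun a b => htr a b⟩
  · refine τ.opNorm_le_bound zero_le_one fun a => ?_
    rw [one_mul]
    exact (hLn _).trans (hC.norm_expectation_le a)
  · have h := τ.le_opNorm (C.coeff 1)
    rwa [hτc, hL1, NonUnitalStarAlgHom.norm_map C.coeff hC.injective, CStarRing.norm_one,
      norm_one, mul_one] at h

end IsRankOne

end CStarCorrespondence

/-! ### Frames of sections -/

namespace HermitianVectorBundle

open Bundle Filter Topology

variable {X : Type u} [TopologicalSpace X] {V : HermitianVectorBundle.{u, v} X}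

theorem finiteDimensional_fiber (V : HermitianVectorBundle.{u, v} X) (x : X) :
    FiniteDimensional ℂ (V.Fiber x) := by
  obtain ⟨n, e, hx, hL⟩ := V.exists_chart x
  obtain ⟨L, -⟩ := hL x hx
  exact LinearEquiv.finiteDimensional L.symm.toLinearEquiv

theorem Sections.sum_apply {ι : Type*} (s : Finset ι) (ξ : ι → V.Sections) (x : X) :
    (∑ i ∈ s, ξ i) x = ∑ i ∈ s, ξ i x := by
  classical
  induction s using Finset.induction_on with
  | empty => rfl
  | insert i s hi ih => rw [Finset.sum_insert hi, Finset.sum_insert hi, Sections.add_apply, ih]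

/-- Cutting off the local section with constant coordinate vector `b` in a chart by a function
supported in the domain of the chart gives a continuous section. -/
theorem exists_section_of_chart {n : ℕ} (e : Trivialization (EuclideanSpace ℂ (Fin n))
      (TotalSpace.proj : TotalSpace Unit V.Fiber → X))
    (L : ∀ y ∈ e.baseSet, V.Fiber y ≃ₗᵢ[ℂ] EuclideanSpace ℂ (Fin n))
    (hL : ∀ y (hy : y ∈ e.baseSet) v, (e ⟨y, v⟩).2 = L y hy v)
    (r : C(X, ℝ)) (hr : tsupport r ⊆ e.baseSet) (b : EuclideanSpace ℂ (Fin n)) :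
    ∃ s : V.Sections, (∀ y (hy : y ∈ e.baseSet), s y = (r y : ℂ) • (L y hy).symm b) ∧
      ∀ y, r y = 0 → s y = 0 := by
  classical
  let s : ∀ y, V.Fiber y := fun y =>
    if hy : y ∈ e.baseSet then (r y : ℂ) • (L y hy).symm b else 0
  have hs0 : ∀ y, r y = 0 → s y = 0 := fun y hy => by simp [s, hy]
  have hs : ∀ y (hy : y ∈ e.baseSet), s y = (r y : ℂ) • (L y hy).symm b :=
    fun y hy => dif_pos hy
  refine ⟨⟨s, continuous_iff_continuousAt.2 fun x => ?_⟩, hs, hs0⟩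
  by_cases hx : x ∈ e.baseSet
  · rw [V.continuousAt_section_iff e hx]
    have h : ContinuousAt (fun y => (r y : ℂ) • b) x := by fun_prop
    refine h.congr ?_
    filter_upwards [e.open_baseSet.mem_nhds hx] with y hy
    rw [hL y hy, hs y hy, map_smul, LinearIsometryEquiv.apply_symm_apply]
  · have h0 : ContinuousAt (fun y => (⟨y, (0 : V.Sections) y⟩ : TotalSpace Unit V.Fiber)) x :=
      (0 : V.Sections).continuous_toFun.continuousAt
    refine h0.congr ?_
    have hx' : x ∉ tsupport r := fun h => hx (hr h)
    filter_upwards [(isClosed_tsupport r).isOpen_compl.mem_nhds hx'] with y hy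
    rw [hs0 y (image_eq_zero_of_notMem_tsupport hy)]
    rfl

/-- Finitely many sections which, at every point, reconstruct every vector of the fibre from its
inner products with them: local orthonormal frames, weighted by the square roots of a partition of
unity. -/
theorem exists_pointwise_frame [CompactSpace X] [T2Space X] (V : HermitianVectorBundle.{u, v} X) :
    ∃ (ι : Type u) (_ : Fintype ι) (ξ : ι → V.Sections),
      ∀ x (v : V.Fiber x), ∑ i, inner ℂ (ξ i x) v • ξ i x = v := by
  classical
  choose n e hx hL using V.exists_chart
  choose L hL using hL
  obtain ⟨t, ht⟩ := (isCompact_univ (X := X)).elim_nhds_subcover (fun x => (e x).baseSet)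
    fun x _ => (e x).open_baseSet.mem_nhds (hx x)
  obtain ⟨ρ, hρ⟩ := PartitionOfUnity.exists_isSubordinate (s := Set.univ) isClosed_univ
    (fun j : t => (e j).baseSet) (fun j => (e j).open_baseSet) fun x hxu => by
      obtain ⟨j, hj, hxj⟩ := Set.mem_iUnion₂.1 (ht.2 hxu)
      exact Set.mem_iUnion.2 ⟨⟨j, hj⟩, hxj⟩
  let r : t → C(X, ℝ) := fun j => ⟨fun x => √(ρ j x), by fun_prop⟩
  have hr : ∀ j, tsupport (r j) ⊆ (e j).baseSet := fun j => by
    refine (closure_mono fun x hxr => ?_).trans (hρ j)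
    simp only [Function.mem_support] at hxr ⊢
    intro h
    exact hxr (by simp [r, h])
  choose ξ hξ hξ0 using fun (j : t) (k : Fin (n j)) =>
    exists_section_of_chart (e j) (L j) (hL j) (r j) (hr j) (EuclideanSpace.single k 1)
  refine ⟨Σ j : t, Fin (n j), inferInstance, fun p => ξ p.1 p.2, fun x v => ?_⟩
  rw [Fintype.sum_sigma]
  have key : ∀ j : t, ∑ k, inner ℂ (ξ j k x) v • ξ j k x = (ρ j x : ℂ) • v := by
    intro j
    have hrr : (r j x : ℂ) * r j x = ρ j x := by
      rw [← Complex.ofReal_mul]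
      exact congrArg _ (Real.mul_self_sqrt (ρ.nonneg j x))
    by_cases hxj : x ∈ (e j).baseSet
    · have h1 := congrArg (L j x hxj).symm
        ((EuclideanSpace.basisFun (Fin (n j)) ℂ).sum_repr' (L j x hxj v))
      rw [map_sum, LinearIsometryEquiv.symm_apply_apply] at h1
      conv_rhs => rw [← h1, Finset.smul_sum]
      refine Finset.sum_congr rfl fun k _ => ?_
      have h2 : inner ℂ ((L j x hxj).symm (EuclideanSpace.single k 1)) v =
          inner ℂ (EuclideanSpace.single k 1) (L j x hxj v) := by
        rw [← (L j x hxj).inner_map_map, LinearIsometryEquiv.apply_symm_apply]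
      rw [hξ j k x hxj, inner_smul_left, h2, map_smul, smul_smul, smul_smul, ← hrr,
        Complex.conj_ofReal, EuclideanSpace.basisFun_apply]
      congr 1; ring
    · have h0 : r j x = 0 := by
        by_contra h
        exact hxj (hr j (subset_tsupport _ h))
      rw [← hrr, h0]
      simp [hξ0 j _ x h0]
  simp_rw [key]
  rw [← Finset.sum_smul, ← Complex.ofReal_sum, ← finsum_eq_sum_of_fintype,
    ρ.sum_eq_one (Set.mem_univ x), Complex.ofReal_one, one_smul]

open CStarCorrespondence

variable [CompactSpace X] {ι : Type*} [Fintype ι] {ξ : ι → V.Sections}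

theorem isFrame_of_pointwise (hξ : ∀ x (v : V.Fiber x), ∑ i, inner ℂ (ξ i x) v • ξ i x = v) :
    IsFrame C(X, ℂ) ξ := by
  intro η
  ext x
  rw [Sections.sum_apply]
  exact hξ x (η x)

omit [CompactSpace X] in
/-- The trace of the identity of a fibre, computed with a frame. -/
theorem sum_inner_self_of_pointwise_frame
    (hξ : ∀ x (v : V.Fiber x), ∑ i, inner ℂ (ξ i x) v • ξ i x = v) (x : X) :
    ∑ i, inner ℂ (ξ i x) (ξ i x) = (Module.finrank ℂ (V.Fiber x) : ℂ) := by
  have := V.finiteDimensional_fiber x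
  let b := stdOrthonormalBasis ℂ (V.Fiber x)
  rw [Finset.sum_congr rfl fun i _ => (b.sum_inner_mul_inner (ξ i x) (ξ i x)).symm,
    Finset.sum_comm]
  have : ∀ k, ∑ i, inner ℂ (ξ i x) (b k) * inner ℂ (b k) (ξ i x) = 1 := fun k => by
    have h := congrArg (inner ℂ (b k)) (hξ x (b k))
    rw [inner_sum] at h
    simp_rw [inner_smul_right] at h
    rw [h, inner_self_eq_norm_sq_to_K, b.orthonormal.1 k]
    simp
  simp [this]

theorem correspondence_φ_apply (α : X ≃ₜ X) (f : C(X, ℂ)) (s : V.Sections) (x : X) :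
    (V.correspondence α).φ f s x = f (α x) • s x := rfl

theorem correspondence_φ_one (α : X ≃ₜ X) (s : V.Sections) : (V.correspondence α).φ 1 s = s := by
  ext x
  rw [correspondence_φ_apply, ContinuousMap.one_apply, one_smul]

theorem correspondence_φ_injective [T2Space X] (hV : ∀ x, Nontrivial (V.Fiber x)) (α : X ≃ₜ X)
    (f : C(X, ℂ)) (hf : (V.correspondence α).φ f = 0) : f = 0 := by
  obtain ⟨ι, _, ξ, hξ⟩ := V.exists_pointwise_frame
  ext y
  obtain ⟨x, rfl⟩ := α.surjective y
  obtain ⟨v, hv⟩ := exists_ne (0 : V.Fiber x)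
  have h : ∀ i, f (α x) • ξ i x = 0 := fun i => by
    rw [← correspondence_φ_apply, hf]; rfl
  have h2 : f (α x) • v = 0 := by
    rw [← hξ x v, Finset.smul_sum]
    exact Finset.sum_eq_zero fun i _ => by rw [smul_comm, h, smul_zero]
  exact (smul_eq_zero.1 h2).resolve_right hv

end HermitianVectorBundle

/-! ### Operators between spaces of square summable families -/

section Spread

variable {I J : Type*} {F : I → Type*} [∀ a, Fintype (F a)] (e : (Σ a, F a) ≃ J)

/-- The operator `ℓ²(I) → ℓ²(J)` which, for a partition of `J` into finite blocks `F a` indexed by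
`a ∈ I`, sends the basis vector `δ_a` to the vector `c a` supported in the block of `a`. -/
def spreadOp (c : ∀ a, EuclideanSpace ℂ (F a)) {M : ℝ} (hM : 0 ≤ M) (hc : ∀ a, ‖c a‖ ≤ M) :
    lp (fun _ : I => ℂ) 2 →L[ℂ] lp (fun _ : J => ℂ) 2 :=
  have key : ∀ h : lp (fun _ : I => ℂ) 2,
      Summable (fun j => ‖c (e.symm j).1 (e.symm j).2 * h (e.symm j).1‖ ^ (2 : ℝ≥0∞).toReal) ∧
      ∑' j, ‖c (e.symm j).1 (e.symm j).2 * h (e.symm j).1‖ ^ (2 : ℝ≥0∞).toReal ≤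
        (M * ‖h‖) ^ (2 : ℝ≥0∞).toReal := by
    intro h
    have h2 : 0 < (2 : ℝ≥0∞).toReal := by norm_num
    have hb : ∀ a, ∑' i, ‖c a i * h a‖ ^ (2 : ℝ≥0∞).toReal = ‖c a‖ ^ 2 * ‖h a‖ ^ 2 := fun a => by
      rw [tsum_fintype, EuclideanSpace.norm_sq_eq, Finset.sum_mul]
      refine Finset.sum_congr rfl fun i _ => ?_
      simp [mul_pow]
    have hh : HasSum (fun a => ‖h a‖ ^ 2) (‖h‖ ^ 2) := by
      simpa using lp.hasSum_norm h2 h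
    have hle : ∀ a, ‖c a‖ ^ 2 * ‖h a‖ ^ 2 ≤ M ^ 2 * ‖h a‖ ^ 2 := fun a => by
      gcongr; exact hc a
    have hs1 : Summable fun a => ‖c a‖ ^ 2 * ‖h a‖ ^ 2 :=
      Summable.of_nonneg_of_le (fun a => by positivity) hle (hh.summable.mul_left _)
    have hs : Summable fun p : Σ a, F a => ‖c p.1 p.2 * h p.1‖ ^ (2 : ℝ≥0∞).toReal := by
      rw [summable_sigma_of_nonneg fun p => by positivity]
      refine ⟨fun a => (hasSum_fintype _).summable, ?_⟩
      simp only [hb]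
      exact hs1
    refine ⟨(e.symm.summable_iff (f := fun p : Σ a, F a =>
      ‖c p.1 p.2 * h p.1‖ ^ (2 : ℝ≥0∞).toReal)).2 hs, ?_⟩
    rw [e.symm.tsum_eq (fun p : Σ a, F a => ‖c p.1 p.2 * h p.1‖ ^ (2 : ℝ≥0∞).toReal),
      hs.tsum_sigma]
    simp only [hb]
    refine (hs1.tsum_le_tsum hle (hh.summable.mul_left _)).trans (le_of_eq ?_)
    rw [(hh.mul_left _).tsum_eq]
    simp [mul_pow]
  LinearMap.mkContinuous
    { toFun := fun h =>
        ⟨fun j => c (e.symm j).1 (e.symm j).2 * h (e.symm j).1, memℓp_gen (key h).1⟩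
      map_add' := fun g h => by
        ext j; exact mul_add _ _ _
      map_smul' := fun z h => by
        ext j; exact mul_left_comm _ _ _ }
    M fun h => lp.norm_le_of_tsum_le (by norm_num) (by positivity) (key h).2

variable (c : ∀ a, EuclideanSpace ℂ (F a)) {M : ℝ} (hM : 0 ≤ M) (hc : ∀ a, ‖c a‖ ≤ M)

theorem spreadOp_apply (h : lp (fun _ : I => ℂ) 2) (a : I) (i : F a) :
    spreadOp e c hM hc h (e ⟨a, i⟩) = c a i * h a := by
  change c (e.symm (e ⟨a, i⟩)).1 (e.symm (e ⟨a, i⟩)).2 * h (e.symm (e ⟨a, i⟩)).1 = _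
  rw [e.symm_apply_apply]

/-- The adjoint takes inner products with `c a` in the block of `a`; this is read off from the inner
product with the image of the basis vector `δ_a`. -/
theorem adjoint_spreadOp_apply (v : lp (fun _ : J => ℂ) 2) (a : I) :
    ContinuousLinearMap.adjoint (spreadOp e c hM hc) v a =
      inner ℂ (c a) (WithLp.toLp 2 fun i => v (e ⟨a, i⟩)) := by
  classical
  have h1 := lp.inner_single_left (𝕜 := ℂ) a (1 : ℂ)
    (ContinuousLinearMap.adjoint (spreadOp e c hM hc) v)
  rw [ContinuousLinearMap.adjoint_inner_right] at h1
  have h2 := (e.hasSum_iff.2 (lp.hasSum_inner (𝕜 := ℂ)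
    (spreadOp e c hM hc (lp.single 2 a 1)) v)).sigma fun b => hasSum_fintype _
  simp only [Function.comp_apply, spreadOp_apply] at h2
  have h3 := h2.unique (hasSum_single a fun b hb => Finset.sum_eq_zero fun i _ => by
    rw [lp.single_apply, Pi.single_eq_of_ne hb, mul_zero, inner_zero_left])
  rw [h1] at h3
  have h4 : inner ℂ (1 : ℂ) (ContinuousLinearMap.adjoint (spreadOp e c hM hc) v a) =
      ContinuousLinearMap.adjoint (spreadOp e c hM hc) v a := by simp
  rw [← h4, h3, PiLp.inner_apply]
  refine Finset.sum_congr rfl fun i _ => ?_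
  rw [lp.single_apply, Pi.single_eq_same, mul_one]

end Spread

/-! ### A faithful covariant representation -/

namespace HermitianVectorBundle

open CStarCorrespondence

variable {X : Type u} [TopologicalSpace X] [CompactSpace X] (V : HermitianVectorBundle.{u, v} X)

/-- The index set `X × ℕ` of the orthonormal basis `δ_{x,k}` of the Hilbert space of the faithful
representation, lifted to the universe in which covariant representations live. -/
abbrev OrbitIndex (X : Type u) : Type (max u v) := ULift.{v} (X × ℕ)

/-- The Hilbert space `ℓ²(X × ℕ)`. -/
abbrev OrbitSpace (X : Type u) : Type (max u v) := lp (fun _ : OrbitIndex.{u, v} X => ℂ) 2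

/-- The dimension of the fibre that is attached to an index. -/
abbrev orbitRank (a : OrbitIndex.{u, v} X) : ℕ := Module.finrank ℂ (V.Fiber a.down.1)

/-- The bijection sending `((x, k), i)`, where `i < n = dim V_x`, to `(α x, k n + i)`. -/
def orbitEquiv (hV : ∀ x, Nontrivial (V.Fiber x)) (α : X ≃ₜ X) :
    (Σ a : OrbitIndex.{u, v} X, Fin (V.orbitRank a)) ≃ OrbitIndex.{u, v} X :=
  have : ∀ x, NeZero (Module.finrank ℂ (V.Fiber x)) := fun x => by
    have := hV x
    have := V.finiteDimensional_fiber x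
    exact ⟨Module.finrank_pos.ne'⟩
  Equiv.ofBijective
    (fun p => ⟨(α p.1.down.1, (Nat.divModEquiv (V.orbitRank p.1)).symm (p.1.down.2, p.2))⟩) <| by
    constructor
    · rintro ⟨⟨x, k⟩, i⟩ ⟨⟨y, l⟩, j⟩ h
      have h1 := congrArg ULift.down h
      obtain rfl : x = y := α.injective (Prod.ext_iff.1 h1).1
      have h2 := (Nat.divModEquiv _).symm.injective (Prod.ext_iff.1 h1).2
      obtain ⟨rfl, rfl⟩ := Prod.mk.inj h2
      rfl
    · rintro ⟨y, m⟩
      obtain ⟨x, rfl⟩ := α.surjective y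
      refine ⟨⟨⟨(x, (Nat.divModEquiv (Module.finrank ℂ (V.Fiber x)) m).1)⟩,
        (Nat.divModEquiv (Module.finrank ℂ (V.Fiber x)) m).2⟩, ?_⟩
      exact congrArg ULift.up (Prod.ext rfl
        ((Nat.divModEquiv (Module.finrank ℂ (V.Fiber x))).symm_apply_apply m))

omit [CompactSpace X] in
theorem orbitEquiv_fst (hV : ∀ x, Nontrivial (V.Fiber x)) (α : X ≃ₜ X)
    (a : OrbitIndex.{u, v} X) (i : Fin (V.orbitRank a)) :
    (V.orbitEquiv hV α ⟨a, i⟩).down.1 = α a.down.1 := rfl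

/-- An orthonormal basis of a fibre. -/
def fiberBasis (x : X) :
    OrthonormalBasis (Fin (Module.finrank ℂ (V.Fiber x))) ℂ (V.Fiber x) :=
  have := V.finiteDimensional_fiber x
  stdOrthonormalBasis ℂ (V.Fiber x)

/-- Multiplication by a function on the first coordinate. -/
def orbitMul (f : C(X, ℂ)) : OrbitSpace.{u, v} X →L[ℂ] OrbitSpace.{u, v} X :=
  spreadOp (Equiv.sigmaUnique (OrbitIndex.{u, v} X) fun _ => Unit)
    (fun a => EuclideanSpace.single () (f a.down.1)) (norm_nonneg f) fun a => by
      rw [PiLp.norm_single]; exact f.norm_coe_le_norm _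

theorem orbitMul_apply (f : C(X, ℂ)) (h : OrbitSpace.{u, v} X) (a : OrbitIndex.{u, v} X) :
    orbitMul f h a = f a.down.1 * h a := by
  have := spreadOp_apply (Equiv.sigmaUnique (OrbitIndex.{u, v} X) fun _ => Unit)
    (fun a => EuclideanSpace.single () (f a.down.1)) (norm_nonneg f) (fun a => by
      rw [PiLp.norm_single]; exact f.norm_coe_le_norm _) h a ()
  rwa [EuclideanSpace.single, PiLp.single_apply, if_pos rfl] at this

theorem adjoint_orbitMul (f : C(X, ℂ)) :
    ContinuousLinearMap.adjoint (orbitMul f) =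
      (orbitMul (star f) : OrbitSpace.{u, v} X →L[ℂ] OrbitSpace.{u, v} X) := by
  ext h a
  rw [orbitMul_apply, orbitMul, adjoint_spreadOp_apply, EuclideanSpace.inner_single_left]
  rfl

/-- The operator `δ_{x,k} ↦ ∑ᵢ ξ(x)ᵢ δ_{α x, k n + i}`. -/
def orbitCreation (hV : ∀ x, Nontrivial (V.Fiber x)) (α : X ≃ₜ X) (ξ : V.Sections) :
    OrbitSpace.{u, v} X →L[ℂ] OrbitSpace.{u, v} X :=
  spreadOp (V.orbitEquiv hV α) (fun a => (V.fiberBasis a.down.1).repr (ξ a.down.1))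
    (norm_nonneg ξ) fun a => by
      rw [LinearIsometryEquiv.norm_map]; exact ξ.norm_apply_le _

theorem orbitCreation_apply (hV : ∀ x, Nontrivial (V.Fiber x)) (α : X ≃ₜ X) (ξ : V.Sections)
    (h : OrbitSpace.{u, v} X) (a : OrbitIndex.{u, v} X) (i : Fin (V.orbitRank a)) :
    V.orbitCreation hV α ξ h (V.orbitEquiv hV α ⟨a, i⟩) =
      (V.fiberBasis a.down.1).repr (ξ a.down.1) i * h a :=
  spreadOp_apply _ _ _ _ _ _ _

theorem adjoint_orbitCreation_apply (hV : ∀ x, Nontrivial (V.Fiber x)) (α : X ≃ₜ X)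
    (ξ : V.Sections) (h : OrbitSpace.{u, v} X) (a : OrbitIndex.{u, v} X) :
    ContinuousLinearMap.adjoint (V.orbitCreation hV α ξ) h a =
      inner ℂ ((V.fiberBasis a.down.1).repr (ξ a.down.1))
        (WithLp.toLp 2 fun i => h (V.orbitEquiv hV α ⟨a, i⟩)) :=
  adjoint_spreadOp_apply _ _ _ _ _ _

omit [CompactSpace X] in
theorem orbit_ext {hV : ∀ x, Nontrivial (V.Fiber x)} {α : X ≃ₜ X}
    {S T : OrbitSpace.{u, v} X →L[ℂ] OrbitSpace.{u, v} X}
    (h : ∀ g a i, S g (V.orbitEquiv hV α ⟨a, i⟩) = T g (V.orbitEquiv hV α ⟨a, i⟩)) : S = T := by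
  ext g b
  obtain ⟨⟨a, i⟩, rfl⟩ := (V.orbitEquiv hV α).surjective b
  exact h g a i

/-- The representation on `ℓ²(X × ℕ)`: functions act by multiplication, and a section `ξ` maps
`δ_{x,k}` to the vector with coordinates `ξ(x)` in the `k`-th block over `α x`. -/
def orbitRep (hV : ∀ x, Nontrivial (V.Fiber x)) (α : X ≃ₜ X) :
    (V.correspondence α).Representation (OrbitSpace.{u, v} X →L[ℂ] OrbitSpace.{u, v} X) where
  π :=
    { toFun := orbitMul
      map_smul' := fun c f => by
        ext h a
        simp only [orbitMul_apply, ContinuousMap.smul_apply, smul_apply,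
          lp.coeFn_smul, Pi.smul_apply, smul_eq_mul, MonoidHom.id_apply]
        ring
      map_zero' := by
        ext h a
        rw [orbitMul_apply, ContinuousMap.zero_apply, zero_mul]; rfl
      map_add' := fun f g => by
        ext h a
        simp only [orbitMul_apply, ContinuousMap.add_apply, add_apply,
          lp.coeFn_add, Pi.add_apply]
        ring
      map_mul' := fun f g => by
        ext h a
        change _ = orbitMul f (orbitMul g h) a
        simp only [orbitMul_apply, ContinuousMap.mul_apply]
        ring
      map_star' := fun f => by
        rw [ContinuousLinearMap.star_eq_adjoint, adjoint_orbitMul] }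
  t :=
    { toFun := V.orbitCreation hV α
      map_add' := fun ξ η => V.orbit_ext (hV := hV) (α := α) fun g a i => by
        simp only [orbitCreation_apply, add_apply,
          lp.coeFn_add, Pi.add_apply, Sections.add_apply, map_add, PiLp.add_apply]
        ring
      map_smul' := fun c ξ => V.orbit_ext (hV := hV) (α := α) fun g a i => by
        simp only [orbitCreation_apply, smul_apply,
          lp.coeFn_smul, Pi.smul_apply, Sections.smul_apply, map_smul, PiLp.smul_apply,
          smul_eq_mul, RingHom.id_apply]
        ring }
  inner_eq ξ η := by
    ext h a
    change orbitMul _ h a = ContinuousLinearMap.adjoint (V.orbitCreation hV α ξ)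
      (V.orbitCreation hV α η h) a
    rw [orbitMul_apply, adjoint_orbitCreation_apply]
    have : (WithLp.toLp 2 fun i => V.orbitCreation hV α η h (V.orbitEquiv hV α ⟨a, i⟩)) =
        h a • (V.fiberBasis a.down.1).repr (η a.down.1) := by
      ext i
      rw [PiLp.smul_apply, smul_eq_mul, mul_comm]
      exact V.orbitCreation_apply hV α η h a i
    rw [this, inner_smul_right, LinearIsometryEquiv.inner_map_map, mul_comm,
      Sections.inner_apply]
  left_mul f ξ := V.orbit_ext (hV := hV) (α := α) fun g a i => by
    change orbitMul f (V.orbitCreation hV α ξ g) _ = V.orbitCreation hV α _ g _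
    rw [orbitMul_apply, orbitCreation_apply, orbitCreation_apply, orbitEquiv_fst,
      correspondence_φ_apply, map_smul, PiLp.smul_apply, smul_eq_mul, mul_assoc]

/-- For a frame `ξ` the operator `∑ t(ξₗ) t(ξₗ)⋆` is the identity: in the block of `(x, k)` it acts as
`∑ ξₗ(x) ⟨ξₗ(x), ·⟩` does on the fibre at `x`. -/
theorem orbitRep_isCovariant [T2Space X] (hV : ∀ x, Nontrivial (V.Fiber x)) (α : X ≃ₜ X) :
    (V.orbitRep hV α).IsCovariant := by
  obtain ⟨ι, _, ξ, hξ⟩ := V.exists_pointwise_frame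
  refine (isFrame_of_pointwise hξ).isCovariant _ fun f => ?_
  have h1 : ∑ l, (V.orbitRep hV α).t (ξ l) * star ((V.orbitRep hV α).t (ξ l)) = 1 := by
    refine V.orbit_ext (hV := hV) (α := α) fun g a i => ?_
    let b := V.fiberBasis a.down.1
    -- The coordinates of `g` in the block of `a`, regarded as a vector of the fibre.
    let u : EuclideanSpace ℂ (Fin (V.orbitRank a)) :=
      WithLp.toLp 2 fun i => g (V.orbitEquiv hV α ⟨a, i⟩)
    have h2 := congrArg (fun v => b.repr v i) (hξ a.down.1 (b.repr.symm u))
    simp only [map_sum, map_smul, LinearIsometryEquiv.apply_symm_apply,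
      WithLp.ofLp_sum, Finset.sum_apply] at h2
    rw [sum_apply, lp.coeFn_sum, Finset.sum_apply]
    refine Eq.trans (Finset.sum_congr rfl fun l _ => ?_) h2
    change V.orbitCreation hV α (ξ l)
      (ContinuousLinearMap.adjoint (V.orbitCreation hV α (ξ l)) g) _ = _
    rw [orbitCreation_apply, adjoint_orbitCreation_apply, PiLp.smul_apply, smul_eq_mul, mul_comm]
    congr 1
    rw [← b.repr.inner_map_map, LinearIsometryEquiv.apply_symm_apply]
  rw [h1, mul_one]

/-- The covariant representation on `ℓ²(X × ℕ)`. -/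
def orbitCovariantRep [T2Space X] (hV : ∀ x, Nontrivial (V.Fiber x)) (α : X ≃ₜ X) :
    (V.correspondence α).CovariantRep where
  B := OrbitSpace.{u, v} X →L[ℂ] OrbitSpace.{u, v} X
  ρ := V.orbitRep hV α
  covariant := V.orbitRep_isCovariant hV α

theorem inner_orbitMul_single [DecidableEq (OrbitIndex.{u, v} X)] (f : C(X, ℂ)) (x : X) :
    inner ℂ (lp.single 2 (ULift.up (x, 0)) 1 : OrbitSpace.{u, v} X)
      (orbitMul f (lp.single 2 (ULift.up (x, 0)) 1)) = f x := by
  rw [lp.inner_single_left, orbitMul_apply, lp.single_apply_self]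
  simp

theorem coeff_injective [T2Space X] (hV : ∀ x, Nontrivial (V.Fiber x)) (α : X ≃ₜ X) :
    Function.Injective (V.correspondence α).coeff := by
  classical
  rw [injective_iff_map_eq_zero]
  intro f hf
  have h : (orbitMul f : OrbitSpace.{u, v} X →L[ℂ] OrbitSpace.{u, v} X) = 0 :=
    congrArg ((V.correspondence α).eval (V.orbitCovariantRep hV α)) hf
  ext x
  rw [← inner_orbitMul_single.{u, v} f x, h]
  simp

/-- The values of `f` are those of vector states of the faithful representation. -/
theorem nonneg_of_coeff_eq [T2Space X] (hV : ∀ x, Nontrivial (V.Fiber x)) (α : X ≃ₜ X)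
    (f : C(X, ℂ)) (s : (V.correspondence α).CuntzPimsner)
    (hs : (V.correspondence α).coeff f = star s * s) : 0 ≤ f := by
  classical
  let S : OrbitSpace.{u, v} X →L[ℂ] OrbitSpace.{u, v} X :=
    (V.correspondence α).eval (V.orbitCovariantRep hV α) s
  have h : orbitMul f = ContinuousLinearMap.adjoint S * S := by
    have h1 := congrArg ((V.correspondence α).eval (V.orbitCovariantRep hV α)) hs
    rw [map_mul, map_star] at h1
    exact h1
  intro x
  change 0 ≤ f x
  rw [← inner_orbitMul_single.{u, v} f x, h]
  change 0 ≤ inner ℂ _ (ContinuousLinearMap.adjoint S (S _))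
  rw [ContinuousLinearMap.adjoint_inner_right, inner_self_eq_norm_sq_to_K]
  norm_cast
  exact Complex.zero_le_real.2 (sq_nonneg _)

end HermitianVectorBundle

/-! ### Invariant measures -/

section InvariantMeasure

open MeasureTheory Filter Topology

/-- The Krylov–Bogoliubov theorem: the averages of the point masses along an orbit accumulate, and
every accumulation point is invariant. -/
theorem exists_invariant_measure {X : Type u} [MetricSpace X] [CompactSpace X] [Nonempty X]
    [MeasurableSpace X] [BorelSpace X] (α : X ≃ₜ X) :
    ∃ μ : Measure X, IsProbabilityMeasure μ ∧ MeasurePreserving α μ μ := by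
  let x : X := Classical.arbitrary X
  let ν : ℕ → Measure X := fun n =>
    ((n + 1 : ℕ) : ℝ≥0∞)⁻¹ • ∑ k ∈ Finset.range (n + 1), Measure.dirac (α^[k] x)
  have hν : ∀ n, IsProbabilityMeasure (ν n) := fun n => ⟨by
    simp only [ν, Measure.smul_apply, Measure.finsetSum_apply, measure_univ, Finset.sum_const,
      Finset.card_range, smul_eq_mul, nsmul_eq_mul, mul_one]
    exact ENNReal.inv_mul_cancel (by simp) (ENNReal.natCast_ne_top _)⟩
  let P : ℕ → ProbabilityMeasure X := fun n => ⟨ν n, hν n⟩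
  let U : Ultrafilter ℕ := Ultrafilter.of atTop
  have hU : (U : Filter ℕ) ≤ atTop := Ultrafilter.of_le atTop
  obtain ⟨Q, -, hQ⟩ := isCompact_univ.ultrafilter_le_nhds (U.map P) (by simp)
  have hlim : Tendsto P U (𝓝 Q) := hQ
  rw [ProbabilityMeasure.tendsto_iff_forall_integral_tendsto] at hlim
  have hint : ∀ n (f : BoundedContinuousFunction X ℝ), ∫ y, f y ∂(ν n) =
      ((n + 1 : ℕ) : ℝ)⁻¹ * ∑ k ∈ Finset.range (n + 1), f (α^[k] x) := fun n f => by
    rw [integral_smul_measure, integral_finsetSum_measure fun k _ => f.integrable _,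
      ENNReal.toReal_inv, ENNReal.toReal_natCast, smul_eq_mul]
    simp only [integral_dirac]
  refine ⟨Q, inferInstance, α.continuous.measurable, ?_⟩
  have : IsProbabilityMeasure (Measure.map α (Q : Measure X)) :=
    Measure.isProbabilityMeasure_map α.continuous.measurable.aemeasurable
  refine ext_of_forall_integral_eq_of_IsFiniteMeasure fun f => ?_
  rw [integral_map α.continuous.measurable.aemeasurable
    f.continuous.aestronglyMeasurable]
  -- The averages of `f ∘ α` and of `f` differ by a telescoping sum, of size `2 ‖f‖ / (n + 1)`.
  let g : BoundedContinuousFunction X ℝ := f.compContinuous ⟨α, α.continuous⟩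
  have h1 := (hlim g).sub (hlim f)
  have h2 : Tendsto (fun n : ℕ => ((n + 1 : ℕ) : ℝ)⁻¹ * (2 * ‖f‖)) U (𝓝 0) := by
    have := (tendsto_one_div_add_atTop_nhds_zero_nat (𝕜 := ℝ)).mul_const (2 * ‖f‖)
    rw [zero_mul] at this
    refine (this.congr fun n => ?_).mono_left hU
    push_cast; rw [one_div]
  have h3 : Tendsto (fun n => ∫ y, g y ∂(P n : Measure X) - ∫ y, f y ∂(P n : Measure X)) U
      (𝓝 0) := by
    refine squeeze_zero_norm (fun n => ?_) h2
    change ‖∫ y, g y ∂(ν n) - ∫ y, f y ∂(ν n)‖ ≤ _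
    rw [hint, hint, ← mul_sub, ← Finset.sum_sub_distrib]
    have : ∀ k, g (α^[k] x) - f (α^[k] x) = f (α^[k + 1] x) - f (α^[k] x) := fun k => by
      rw [Function.iterate_succ_apply']; rfl
    simp_rw [this]
    rw [Finset.sum_range_sub (fun k => f (α^[k] x)), norm_mul, norm_inv, Real.norm_natCast]
    gcongr
    refine (norm_sub_le _ _).trans ?_
    rw [two_mul]
    exact add_le_add (f.norm_coe_le_norm _) (f.norm_coe_le_norm _)
  exact sub_eq_zero.1 (tendsto_nhds_unique h1 h3)

/-- The support of an invariant measure of a minimal homeomorphism is everything. -/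
theorem IsMinimalHomeo.isOpenPosMeasure {X : Type u} [MetricSpace X] [CompactSpace X]
    [MeasurableSpace X] [BorelSpace X] {α : X ≃ₜ X} (hα : IsMinimalHomeo α) {μ : Measure X}
    [IsProbabilityMeasure μ] (hμ : MeasurePreserving α μ μ) : μ.IsOpenPosMeasure := by
  have hK : α '' μ.support ⊆ μ.support := by
    rintro _ ⟨x, hx, rfl⟩
    rw [Measure.mem_support_iff_forall] at hx ⊢
    intro W hW
    obtain ⟨O, hOW, hO, hxO⟩ := mem_nhds_iff.1 hW
    refine lt_of_lt_of_le ?_ (measure_mono hOW)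
    rw [← hμ.measure_preimage hO.measurableSet.nullMeasurableSet]
    exact hx _ ((hO.preimage α.continuous).mem_nhds hxO)
  have huniv : μ.support = Set.univ := by
    refine (hα _ Measure.isClosed_support hK).resolve_left ?_
    exact (Measure.nonempty_support (IsProbabilityMeasure.ne_zero μ)).ne_empty
  refine ⟨fun O hO ⟨x, hx⟩ h0 => ?_⟩
  have hx' : x ∈ μ.support := huniv ▸ Set.mem_univ x
  rw [Measure.mem_support_iff_forall] at hx'
  exact (hx' O (hO.mem_nhds hx)).ne' h0

end InvariantMeasure

/-! ### Traces and stable finiteness -/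

/-- A unital C⋆-algebra with a faithful tracial state is stably finite: if `s⋆ s = 1` in a matrix
algebra, then the entries of the projection `p = 1 - s s⋆` satisfy
`∑ τ(pᵢⱼ⋆ pᵢⱼ) = (τ ⊗ tr)(p) = 0`. -/
theorem isStablyFinite_of_faithful_trace {B : Type w} [NonUnitalCStarAlgebra B]
    {τ : B →L[ℂ] ℂ} (hτ : IsTracialState τ) (hf : IsFaithfulFunctional τ) {e : B}
    (he : ∀ b, e * b = b ∧ b * e = b) : IsStablyFiniteCStar B := by
  classical
  refine ⟨e, he, fun n s hs => ?_⟩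
  have hes : star e = e := by
    rw [← (he (star e)).1]
    conv_rhs => rw [← star_star e, ← (he (star e)).1, star_mul, star_star]
  set D : Matrix (Fin n) (Fin n) B := Matrix.diagonal fun _ => e with hD
  have hD1 : ∀ m : Matrix (Fin n) (Fin n) B, D * m = m ∧ m * D = m := fun m => by
    constructor <;> ext i j
    · rw [hD, Matrix.diagonal_mul, (he _).1]
    · rw [hD, Matrix.mul_diagonal, (he _).2]
  have hDs : D.conjTranspose = D := by
    rw [hD, Matrix.diagonal_conjTranspose]
    congr 1; funext i; exact hes
  set p := D - s * s.conjTranspose with hp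
  have hpp : p.conjTranspose * p = p := by
    have h1 : (s * s.conjTranspose).conjTranspose = s * s.conjTranspose := by
      rw [Matrix.conjTranspose_mul, Matrix.conjTranspose_conjTranspose]
    have h2 : s * s.conjTranspose * (s * s.conjTranspose) = s * s.conjTranspose := by
      rw [Matrix.mul_assoc, ← Matrix.mul_assoc s.conjTranspose, hs, (hD1 _).1]
    rw [hp, Matrix.conjTranspose_sub, hDs, h1, Matrix.sub_mul, Matrix.mul_sub, Matrix.mul_sub,
      (hD1 _).1, (hD1 _).1, (hD1 _).2, h2, sub_self, sub_zero]
  have htr : ∀ a b : Matrix (Fin n) (Fin n) B, τ (a * b).trace = τ (b * a).trace := fun a b => by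
    simp only [Matrix.trace, Matrix.diag_apply, Matrix.mul_apply, map_sum]
    rw [Finset.sum_comm]
    exact Finset.sum_congr rfl fun i _ => Finset.sum_congr rfl fun j _ => hτ.tracial _ _
  have h0 : τ (p.conjTranspose * p).trace = 0 := by
    rw [hpp, hp, Matrix.trace_sub, map_sub, htr s, hs, sub_self]
  simp only [Matrix.trace, Matrix.diag_apply, Matrix.mul_apply, map_sum,
    Matrix.conjTranspose_apply] at h0
  have hp0 : p = 0 := by
    ext i j
    rw [Finset.sum_eq_zero_iff_of_nonneg fun i _ =>
      Finset.sum_nonneg fun j _ => hτ.nonneg _] at h0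
    have h1 := h0 j (Finset.mem_univ j)
    rw [Finset.sum_eq_zero_iff_of_nonneg fun j _ => hτ.nonneg _] at h1
    exact hf _ (h1 i (Finset.mem_univ i))
  exact (sub_eq_zero.1 hp0).symm

namespace HermitianVectorBundle

open CStarCorrespondence MeasureTheory

variable {X : Type u} [MetricSpace X] [CompactSpace X] (V : HermitianVectorBundle.{u, v} X)

/-- With a frame `ξ`, a trace satisfies
`τ(π(1)) = ∑ τ(t(ξᵢ) t(ξᵢ)⋆) = ∑ τ(t(ξᵢ)⋆ t(ξᵢ)) = τ(π(dim V))`, so a faithful one forces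
`dim V = 1`. -/
theorem isLineBundle_of_faithful_trace (hV : ∀ x, Nontrivial (V.Fiber x)) (α : X ≃ₜ X)
    {τ : (V.correspondence α).CuntzPimsner →L[ℂ] ℂ} (hτ : IsTracialState τ)
    (hf : IsFaithfulFunctional τ) : V.IsLineBundle := by
  obtain ⟨ι, _, ξ, hξ⟩ := V.exists_pointwise_frame
  have hfr := isFrame_of_pointwise hξ
  have h1 : (V.correspondence α).coeff 1 =
      ∑ i, (V.correspondence α).creation (ξ i) * star ((V.correspondence α).creation (ξ i)) := by
    refine (V.correspondence α).coeff_eq_sum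
      (hfr.mem_katsuraIdeal _ (correspondence_φ_injective hV α) 1) ?_
    rw [hfr.φ_eq_sum (V.correspondence α) 1]
    simp_rw [correspondence_φ_one α]
  have h2 : τ ((V.correspondence α).coeff 1) =
      τ ((V.correspondence α).coeff (∑ i, inner C(X, ℂ) (ξ i) (ξ i))) := by
    rw [h1, map_sum, map_sum, map_sum]
    exact Finset.sum_congr rfl fun i _ => by rw [hτ.tracial, coeff_inner]
  set d : C(X, ℂ) := ∑ i, inner C(X, ℂ) (ξ i) (ξ i) with hd
  have hdx : ∀ x, d x = (Module.finrank ℂ (V.Fiber x) : ℂ) := fun x => by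
    rw [hd, ContinuousMap.coe_sum, Finset.sum_apply]
    exact sum_inner_self_of_pointwise_frame hξ x
  -- `g = √(dim V - 1)`, so that `g⋆ g` has trace zero.
  let g : C(X, ℂ) := ⟨fun x => (√((d x).re - 1) : ℂ), by fun_prop⟩
  have hgx : ∀ x, g x * g x = d x - 1 := fun x => by
    have := hV x
    have := V.finiteDimensional_fiber x
    have h3 : (1 : ℝ) ≤ Module.finrank ℂ (V.Fiber x) := by
      exact_mod_cast Module.finrank_pos (R := ℂ) (M := V.Fiber x)
    change ((√((d x).re - 1) : ℝ) : ℂ) * (√((d x).re - 1) : ℝ) = _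
    rw [← Complex.ofReal_mul, hdx, Complex.natCast_re, Real.mul_self_sqrt (by linarith)]
    push_cast; rfl
  have hgg : star g * g = d - 1 := by
    ext x
    change star ((√((d x).re - 1) : ℝ) : ℂ) * g x = _
    rw [Complex.star_def, Complex.conj_ofReal]
    exact hgx x
  have hg0 : (V.correspondence α).coeff g = 0 := by
    refine hf _ ?_
    rw [← map_star, ← map_mul, hgg, map_sub, map_sub, h2, sub_self]
  have hg : g = 0 := coeff_injective V hV α (by rw [map_zero]; exact hg0)
  intro x
  have h4 := hgx x
  rw [hg, hdx, ContinuousMap.zero_apply, mul_zero] at h4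
  exact_mod_cast (sub_eq_zero.1 h4.symm)

variable {V}

omit [CompactSpace X] in
theorem IsLineBundle.nontrivial (hL : V.IsLineBundle) (x : X) : Nontrivial (V.Fiber x) :=
  Module.nontrivial_of_finrank_pos (R := ℂ) (by rw [hL x]; exact one_pos)

/-- In a one-dimensional space `⟨v, w⟩ u = ⟨v, u⟩ w`, so rank one operators on sections of a line
bundle are multiplication operators. -/
theorem IsLineBundle.creation_mul_star (hL : V.IsLineBundle) (α : X ≃ₜ X) (ξ η : V.Sections) :
    (V.correspondence α).creation ξ * star ((V.correspondence α).creation η) =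
      (V.correspondence α).coeff ((inner C(X, ℂ) η ξ : C(X, ℂ)).comp (α.symm : C(X, X))) := by
  obtain ⟨ι, _, ζ, hζ⟩ := V.exists_pointwise_frame
  symm
  have := (V.correspondence α).coeff_eq_sum (ι := Unit) (η := fun _ => ξ) (ζ := fun _ => η)
    ((isFrame_of_pointwise hζ).mem_katsuraIdeal _
      (correspondence_φ_injective hL.nontrivial α)
      ((inner C(X, ℂ) η ξ : C(X, ℂ)).comp (α.symm : C(X, X)))) ?_
  · simpa using this
  · rw [Finset.univ_unique, Finset.sum_singleton]
    ext s x
    rw [correspondence_φ_apply]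
    change inner ℂ (η (α.symm (α x))) (ξ (α.symm (α x))) • s x = inner ℂ (η x) (s x) • ξ x
    rw [α.symm_apply_apply]
    obtain ⟨v, -, hv⟩ := finrank_eq_one_iff'.1 (hL x)
    obtain ⟨a, ha⟩ := hv (s x)
    obtain ⟨b, hb⟩ := hv (ξ x)
    rw [← ha, ← hb, inner_smul_right, inner_smul_right, smul_smul, smul_smul]
    congr 1; ring

theorem IsLineBundle.isRankOne (hL : V.IsLineBundle) (α : X ≃ₜ X) :
    (V.correspondence α).IsRankOne where
  φ_one := correspondence_φ_one α
  creation_mul_star ξ η := ⟨_, (hL.creation_mul_star α ξ η).symm⟩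
  injective := coeff_injective V hL.nontrivial α
  nonneg := V.nonneg_of_coeff_eq hL.nontrivial α

variable [MeasurableSpace X] [BorelSpace X]

/-- Integration of continuous functions against a probability measure. -/
def integralL (μ : Measure X) [IsProbabilityMeasure μ] : C(X, ℂ) →L[ℂ] ℂ :=
  LinearMap.mkContinuous
    { toFun := fun f => ∫ x, f x ∂μ
      map_add' := fun f g => integral_add
        (f.continuous.integrable_of_hasCompactSupport (.of_compactSpace f))
        (g.continuous.integrable_of_hasCompactSupport (.of_compactSpace g))
      map_smul' := fun c f => integral_const_mul c _ } 1 fun f => by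
    simpa using norm_integral_le_of_norm_le_const (μ := μ)
      (Filter.Eventually.of_forall f.norm_coe_le_norm)

theorem integralL_apply (μ : Measure X) [IsProbabilityMeasure μ] (f : C(X, ℂ)) :
    integralL μ f = ∫ x, f x ∂μ := rfl

theorem IsLineBundle.isTracialState [Nonempty X] (hL : V.IsLineBundle) (α : X ≃ₜ X)
    (μ : Measure X) [IsProbabilityMeasure μ] (hμ : MeasurePreserving α μ μ) :
    IsTracialState ((integralL μ).comp (hL.isRankOne α).expectation) := by
  refine (hL.isRankOne α).isTracialState_comp_expectation (integralL μ) (fun f hf => ?_)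
    (fun f => ?_) ?_ (fun f => ?_) (fun ξ η f hf => ?_)
  · exact integral_nonneg fun x => hf x
  · simpa [integralL_apply] using norm_integral_le_of_norm_le_const (μ := μ)
      (Filter.Eventually.of_forall f.norm_coe_le_norm)
  · simp [integralL_apply]
  · exact integral_conj
  · rw [hL.creation_mul_star] at hf
    rw [(hL.isRankOne α).injective hf, integralL_apply, integralL_apply,
      ← hμ.integral_comp α.measurableEmbedding]
    refine integral_congr_ae (Filter.Eventually.of_forall fun x => ?_)
    change (inner C(X, ℂ) η ξ : C(X, ℂ)) (α.symm (α x)) = _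
    rw [α.symm_apply_apply]

/-- A trace coming from a measure of full support is faithful: a non-negative continuous function
with vanishing integral vanishes, and the gauge expectation is faithful. -/
theorem IsLineBundle.isFaithful (hL : V.IsLineBundle) (α : X ≃ₜ X)
    (μ : Measure X) [IsProbabilityMeasure μ] [μ.IsOpenPosMeasure] :
    IsFaithfulFunctional ((integralL μ).comp (hL.isRankOne α).expectation) := by
  intro a ha
  refine (hL.isRankOne α).eq_zero_of_expectation_eq_zero ?_
  set f := (hL.isRankOne α).expectation (star a * a)
  have hf : ∀ x, 0 ≤ f x := (hL.isRankOne α).expectation_nonneg a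
  have hre : ∀ x, ((f x).re : ℂ) = f x := fun x => (Complex.eq_re_of_ofReal_le (hf x)).symm
  have h0 : ∫ x, (f x).re ∂μ = 0 := by
    have : ∫ x, ((f x).re : ℂ) ∂μ = 0 := by
      rw [integral_congr_ae (.of_forall hre)]; exact ha
    rw [integral_complex_ofReal] at this
    exact_mod_cast this
  have hc : Continuous fun x => (f x).re := by fun_prop
  rw [integral_eq_zero_iff_of_nonneg (fun x => (Complex.le_def.1 (hf x)).1)
    (hc.integrable_of_hasCompactSupport (.of_compactSpace _))] at h0
  have h1 := (hc.ae_eq_iff_eq μ continuous_const).1 h0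
  ext x
  rw [← hre x]
  exact congrArg Complex.ofReal (congrFun h1 x)

end HermitianVectorBundle

end

theorem mainTheorem12 {X : Type u} [MetricSpace X] [CompactSpace X] [Nonempty X]
    [MeasurableSpace X] [BorelSpace X] (V : HermitianVectorBundle.{u, v} X) (α : X ≃ₜ X) :
    ((∀ x, Nontrivial (V.Fiber x)) → ¬ V.IsLineBundle →
      ¬ ∃ τ : (V.correspondence α).CuntzPimsner →L[ℂ] ℂ,
        IsTracialState τ ∧ IsFaithfulFunctional τ) ∧
    (V.IsLineBundle →
      (∃ μ : MeasureTheory.Measure X,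
        MeasureTheory.IsProbabilityMeasure μ ∧ MeasureTheory.MeasurePreserving α μ μ) ∧
      Function.Injective (V.correspondence α).coeff ∧
      (∀ a, (V.correspondence α).gaugeExpectation a ∈ Set.range (V.correspondence α).coeff) ∧
      (∀ μ : MeasureTheory.Measure X, MeasureTheory.IsProbabilityMeasure μ →
        MeasureTheory.MeasurePreserving α μ μ →
          ∃ τ : (V.correspondence α).CuntzPimsner →L[ℂ] ℂ, IsTracialState τ ∧
            ∀ a f, (V.correspondence α).coeff f = (V.correspondence α).gaugeExpectation a →
              τ a = ∫ x, f x ∂μ) ∧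
      (∃ τ : (V.correspondence α).CuntzPimsner →L[ℂ] ℂ, IsTracialState τ) ∧
      (IsMinimalHomeo α → IsStablyFiniteCStar (V.correspondence α).CuntzPimsner)) := by
  refine ⟨fun hV hL ⟨τ, hτ, hf⟩ => hL (V.isLineBundle_of_faithful_trace hV α hτ hf), fun hL => ?_⟩
  have hC := hL.isRankOne α
  obtain ⟨μ, hμ, hμα⟩ := exists_invariant_measure α
  refine ⟨⟨μ, hμ, hμα⟩, hC.injective, hC.gaugeExpectation_mem_range, fun ν hν hνα => ?_,
    ⟨_, hL.isTracialState α μ hμα⟩, fun hα => ?_⟩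
  · refine ⟨_, hL.isTracialState α ν hνα, fun a f hf => ?_⟩
    rw [← hC.coeff_expectation] at hf
    rw [hC.injective hf]
    rfl
  · have := hα.isOpenPosMeasure hμα
    exact isStablyFinite_of_faithful_trace (hL.isTracialState α μ hμα) (hL.isFaithful α μ)
      ((V.correspondence α).coeff_one_unit hC.φ_one)
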